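/- Let $K$ be an algebraically closed field of characteristic $0$, let $G$ be a finite abelian group (written additively), let $n\ge 1$, and let $\Gamma\colon M_n(K)=\bigoplus_{g\in G}A_g$ be a $G$-grading. Conventions. Let $e_{i,j}$ denote the matrix units. For $t=(t_1,\dots,t_r)\in G^r$, the elementary grading of $M_r(K)$ defined by $t$ has as component of degree $g$ the span of the $e_{i,j}$ with $t_j-t_i=g$; a grading of $M_n(K)$ is elementary if it is the elementary grading defined by some tuple in $G^n$. For a subgroup $Q\le G$ and a $2$-cocycle $\alpha\colon Q\times Q\to K^*$ (trivial action), $K^\alpha Q$ is the twisted group algebra with basis $\{X_q\mid q\in Q\}$ and product $X_pX_q=\alpha(p,q)X_{p+q}$, and the bicharacter induced by $\alpha$ is $\beta_\alpha(p,q)=\alpha(p,q)\alpha(q,p)^{-1}$; it is trivial if it is constantly $1$. The tensor product $K^\alpha Q\otimes M_r(K)$ is graded by giving $X_q\otimes e_{i,j}$ the degree $q+(t_j-t_i)$. Let $K\langle X_G\rangle$ be the free unital associative algebra on countably many variables of each degree $g\in G$. For a $G$-graded algebra $A$, an element $f\in K\langle X_G\rangle$ is a graded central polynomial of $A$ if all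 its values under substitutions of variables of degree $g$ by elements of $A_g$ (for all $g$) are central in $A$; it is proper if, moreover, not all these values are $0$. The graded algebra $A$ has the primeness property for graded central polynomials if, whenever $f,h\in K\langle X_G\rangle$ are polynomials in disjoint sets of variables and $fh$ is a proper graded central polynomial of $A$, both $f$ and $h$ are proper graded central polynomials of $A$. Theorem. There exist a subgroup $Q$ of $G$, a $2$-cocycle $\alpha\colon Q\times Q\to K^*$, an integer $r\ge 1$ and a tuple $t\in G^r$ such that $(M_n(K),\Gamma)$ is isomorphic, as a $G$-graded algebra, to $K^\alpha Q\otimes M_r(K)$ with the grading above. Moreover, for every such $Q,\alpha,r,t$: (i) If the bicharacter induced by $\alpha$ is non-trivial and $(M_n(K),\Gamma)$ has the primeness property for graded central polynomials, then $\Gamma$ is an elementary grading. (ii) If the bicharacter induced by $\alpha$ is trivial, then $(M_n(K),\Gamma)$ has the primeness property for graded central polynomials if and only if $M_r(K)$, with the elementary grading defined by $t$, has it. -/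

import Mathlib

open scoped TensorProduct

/-- A 2-cocycle `Q × Q → Kˣ` of an additively written abelian group `Q`, acting trivially on `Kˣ`
(not assumed to be normalized). -/
structure TwoCocycle (Q K : Type*) [AddCommGroup Q] [Field K] where
  toFun : Q → Q → Kˣ
  cocycle : ∀ a b c : Q, toFun a b * toFun (a + b) c = toFun b c * toFun a (b + c)

namespace TwoCocycle

variable {Q K : Type*} [AddCommGroup Q] [Field K]

/-- The bicharacter induced by a 2-cocycle: `β(a, b) = α(a, b) α(b, a)⁻¹`. -/
def bicharacter (α : TwoCocycle Q K) (a b : Q) : Kˣ := α.toFun a b * (α.toFun b a)⁻¹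

/-- The bicharacter induced by `α` is trivial, that is, constantly `1`. -/
def HasTrivialBicharacter (α : TwoCocycle Q K) : Prop := ∀ a b : Q, α.bicharacter a b = 1

theorem zero_left (α : TwoCocycle Q K) (c : Q) : α.toFun 0 c = α.toFun 0 0 := by
  have h := α.cocycle 0 0 c
  simp only [zero_add] at h
  exact (mul_right_cancel h).symm

theorem zero_right (α : TwoCocycle Q K) (a : Q) : α.toFun a 0 = α.toFun 0 0 := by
  have h := α.cocycle a 0 0
  simp only [add_zero] at h
  exact mul_right_cancel h

end TwoCocycle

/-- The twisted group algebra `K^α Q`: the vector space with basis `X_a`, `a ∈ Q`, and the product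
`X_a X_b = α(a, b) X_{a + b}`. -/
def TwistedGroupAlgebra {Q K : Type*} [AddCommGroup Q] [Field K] (_α : TwoCocycle Q K) : Type _ :=
  Q →₀ K

namespace TwistedGroupAlgebra

variable {Q K : Type*} [AddCommGroup Q] [Field K] (α : TwoCocycle Q K)

noncomputable instance : AddCommGroup (TwistedGroupAlgebra α) :=
  inferInstanceAs (AddCommGroup (Q →₀ K))

noncomputable instance : Module K (TwistedGroupAlgebra α) :=
  inferInstanceAs (Module K (Q →₀ K))

/-- The canonical basis element `X_a`. -/
noncomputable def X (a : Q) : TwistedGroupAlgebra α := Finsupp.single a (1 : K)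

/-- Multiplication as a bilinear map, given on the canonical basis by
`X_a X_b = α(a, b) X_{a + b}`. -/
noncomputable def mulHom :
    TwistedGroupAlgebra α →ₗ[K] TwistedGroupAlgebra α →ₗ[K] TwistedGroupAlgebra α :=
  Finsupp.linearCombination K fun a : Q =>
    (Finsupp.linearCombination K fun b : Q => (α.toFun a b : K) • X α (a + b) :
      (Q →₀ K) →ₗ[K] TwistedGroupAlgebra α)

theorem mulHom_X_X (a b : Q) :
    mulHom α (X α a) (X α b) = (α.toFun a b : K) • X α (a + b) := by
  unfold mulHom
  erw [Finsupp.linearCombination_single, one_smul, Finsupp.linearCombination_single, one_smul]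

theorem induction_X {p : TwistedGroupAlgebra α → Prop} (h0 : p 0)
    (hadd : ∀ x y, p x → p y → p (x + y)) (hX : ∀ (c : K) (a : Q), p (c • X α a))
    (x : TwistedGroupAlgebra α) : p x := by
  refine Finsupp.induction_linear (motive := p) x h0 hadd fun a c => ?_
  have h : (Finsupp.single a c : Q →₀ K) = c • Finsupp.single a (1 : K) := by simp
  rw [h]
  exact hX c a

noncomputable instance : Mul (TwistedGroupAlgebra α) := ⟨fun x y => mulHom α x y⟩

/-- The unit is `α(0, 0)⁻¹ X_0`. -/
noncomputable instance : One (TwistedGroupAlgebra α) := ⟨((α.toFun 0 0)⁻¹ : Kˣ).val • X α 0⟩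

theorem mul_def (x y : TwistedGroupAlgebra α) : x * y = mulHom α x y := rfl

theorem one_def : (1 : TwistedGroupAlgebra α) = ((α.toFun 0 0)⁻¹ : Kˣ).val • X α 0 := rfl

noncomputable instance : Ring (TwistedGroupAlgebra α) :=
  { (inferInstance : AddCommGroup (TwistedGroupAlgebra α)),
    (inferInstance : Mul (TwistedGroupAlgebra α)),
    (inferInstance : One (TwistedGroupAlgebra α)) with
    left_distrib := fun x y z => by simp only [mul_def, map_add]
    right_distrib := fun x y z => by simp only [mul_def, map_add, LinearMap.add_apply]
    zero_mul := fun x => by simp only [mul_def, map_zero, LinearMap.zero_apply]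
    mul_zero := fun x => by simp only [mul_def, map_zero]
    mul_assoc := fun x y z => by
      simp only [mul_def]
      induction x using induction_X with
      | h0 => simp
      | hadd x x' h h' => simp [h, h']
      | hX c a =>
        induction y using induction_X with
        | h0 => simp
        | hadd y y' h h' => simp only [map_add, LinearMap.add_apply, h, h']
        | hX d b =>
          induction z using induction_X with
          | h0 => simp
          | hadd z z' h h' => simp only [map_add, h, h']
          | hX e f =>
            have h := congrArg Units.val (α.cocycle a b f)
            simp only [Units.val_mul] at h
            simp only [map_smul, LinearMap.smul_apply, mulHom_X_X, smul_smul, add_assoc]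
            congr 1
            linear_combination (e * c * d) * h
    one_mul := fun x => by
      simp only [mul_def, one_def]
      induction x using induction_X with
      | h0 => simp
      | hadd x x' h h' => simp only [map_add, h, h']
      | hX c a =>
        simp only [map_smul, LinearMap.smul_apply, mulHom_X_X, smul_smul, zero_add,
          α.zero_left a]
        congr 1
        rw [Units.inv_mul, mul_one]
    mul_one := fun x => by
      simp only [mul_def, one_def]
      induction x using induction_X with
      | h0 => simp
      | hadd x x' h h' => simp only [map_add, LinearMap.add_apply, h, h']
      | hX c a =>
        simp only [map_smul, LinearMap.smul_apply, mulHom_X_X, smul_smul, add_zero,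
          α.zero_right a]
        congr 1
        rw [mul_left_comm, Units.inv_mul, mul_one] }

noncomputable instance : Algebra K (TwistedGroupAlgebra α) :=
  Algebra.ofModule
    (fun r x y => by simp only [mul_def, map_smul, LinearMap.smul_apply])
    (fun r x y => by simp only [mul_def, map_smul])

theorem X_mul_X (a b : Q) : X α a * X α b = (α.toFun a b : K) • X α (a + b) := mulHom_X_X α a b

end TwistedGroupAlgebra

section Gradings

variable {K G : Type*} [Field K] [AddCommGroup G]

/-- The elementary grading on `M_r(K)` defined by the tuple `t`: the component of degree `g` is
spanned by the matrix units `e_{i,j}` with `t_j - t_i = g`. -/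
def elementaryGrading (K : Type*) [Field K] {r : ℕ} (t : Fin r → G) (g : G) :
    Submodule K (Matrix (Fin r) (Fin r) K) :=
  Submodule.span K {m | ∃ i j : Fin r, t j - t i = g ∧ m = Matrix.single i j (1 : K)}

/-- A grading on a matrix algebra is elementary if it is the elementary grading of some tuple. -/
def IsElementaryGrading {n : ℕ} (Γ : G → Submodule K (Matrix (Fin n) (Fin n) K)) : Prop :=
  ∃ t : Fin n → G, ∀ g : G, Γ g = elementaryGrading K t g

/-- The tensor product grading on `K^α Q ⊗ M_r(K)`, for a subgroup `Q` of `G`: here `X_q` has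
degree `q` and `M_r(K)` has the elementary grading defined by `t`, so the component of degree `g`
is spanned by the `X_q ⊗ e_{i,j}` with `q + (t_j - t_i) = g`. -/
noncomputable def tensorGrading {Q : AddSubgroup G} (α : TwoCocycle Q K) {r : ℕ} (t : Fin r → G) (g : G) :
    Submodule K (TwistedGroupAlgebra α ⊗[K] Matrix (Fin r) (Fin r) K) :=
  Submodule.span K {m | ∃ (q : Q) (i j : Fin r), (q : G) + (t j - t i) = g ∧
    m = TwistedGroupAlgebra.X α q ⊗ₜ[K] Matrix.single i j (1 : K)}

/-- Two `G`-graded algebras are isomorphic if some algebra isomorphism maps the component of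
degree `g` onto the component of degree `g`, for every `g`. -/
def GradedIsomorphic {A B : Type*} [Ring A] [Algebra K A] [Ring B] [Algebra K B]
    (𝒜 : G → Submodule K A) (ℬ : G → Submodule K B) : Prop :=
  ∃ φ : A ≃ₐ[K] B, ∀ g : G, (𝒜 g).map φ.toLinearMap = ℬ g

/-- The free unital `G`-graded algebra `K⟨X_G⟩`; the variable `(g, i)` is the `i`-th variable
of degree `g`. -/
abbrev GradedPolynomial (K G : Type*) [Field K] : Type _ := FreeAlgebra K (G × ℕ)

/-- `f` is a polynomial in the variables of the set `S`. -/
def GradedPolynomial.InVariables (f : GradedPolynomial K G) (S : Set (G × ℕ)) : Prop :=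
  f ∈ Algebra.adjoin K (FreeAlgebra.ι K '' S)

variable {A : Type*} [Ring A] [Algebra K A]

/-- A substitution is admissible if the variables of degree `g` get values of degree `g`. -/
def AdmissibleSubstitution (𝒜 : G → Submodule K A) (a : G × ℕ → A) : Prop :=
  ∀ v : G × ℕ, a v ∈ 𝒜 v.1

/-- `f` is a graded polynomial identity. -/
def IsGradedIdentity (𝒜 : G → Submodule K A) (f : GradedPolynomial K G) : Prop :=
  ∀ a : G × ℕ → A, AdmissibleSubstitution 𝒜 a → FreeAlgebra.lift K a f = 0

/-- `f` is a graded central polynomial. -/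
def IsGradedCentral (𝒜 : G → Submodule K A) (f : GradedPolynomial K G) : Prop :=
  ∀ a : G × ℕ → A, AdmissibleSubstitution 𝒜 a → FreeAlgebra.lift K a f ∈ Subalgebra.center K A

/-- `f` is a proper graded central polynomial. -/
def IsProperGradedCentral (𝒜 : G → Submodule K A) (f : GradedPolynomial K G) : Prop :=
  IsGradedCentral 𝒜 f ∧ ¬ IsGradedIdentity 𝒜 f

/-- The primeness property for graded central polynomials. -/
def HasPrimenessProperty (𝒜 : G → Submodule K A) : Prop :=
  ∀ (S T : Set (G × ℕ)) (f g : GradedPolynomial K G), Disjoint S T →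
    f.InVariables S → g.InVariables T → IsProperGradedCentral 𝒜 (f * g) →
      IsProperGradedCentral 𝒜 f ∧ IsProperGradedCentral 𝒜 g

end Gradings

/-! Structure. A matrix algebra is prime and finite-dimensional. A nonzero homogeneous `a` with `A
a` of least dimension yields, by primeness, an idempotent `e` of degree 0 whose corner `e A e` is a
graded division algebra. Over an algebraically closed field its components have dimension at most
one, so the corner is `K^α Q`, with `Q` its support. A homogeneous basis of `A e` over the corner,
with its dual basis, identifies `A` with `K^α Q ⊗ M_r(K)` (`exists_twisted_basis_corner`,
`exists_homogeneous_frame`, `gradedIsomorphic_tensorGrading_of_frame`).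

Primeness property. It forces the grading into degree 0 (`HasPrimenessProperty.eq_bot_of_ne_zero`).
A character `χ` of `G` acts by an automorphism, which is conjugation by some `v`; thus `v a = χ(g) a
v` for `a` of degree `g`. The twisted commutators `a b - χ(g) b a` span the hyperplane orthogonal to
`v` under the trace form. A Capelli polynomial in `n²` alternating variables, with one of them
stripped off by cyclicity of the trace and twisted commutators in the others, takes values in `K v`
and is not an identity (`exists_polynomial_values_smul`). The same holds for `v⁻¹` and `χ⁻¹`. In
disjoint variables the product of the two polynomials is proper central, so `v` is central and `χ`
is 1 on the support of the grading. Characters separate the points of `G`, so the support is `{0}`.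

Trivial bicharacter. Then `K^α Q` is commutative, hence central in a central algebra, hence equal to
`K`; so `Q = 0` and only the elementary factor remains. -/

section GradedPrime

/-! ### Minimal graded left ideals and their graded division corners. -/

variable {K G A : Type*} [Field K] [AddCommGroup G] [DecidableEq G] [Ring A] [Algebra K A]

theorem exists_homogeneous_ne_zero {M : Type*} [AddCommGroup M] [Module K M]
    (𝒜 : G → Submodule K A) [GradedAlgebra 𝒜] (f : A →ₗ[K] M) {x : A} (hx : f x ≠ 0) :
    ∃ g, ∃ y ∈ 𝒜 g, f y ≠ 0 := by
  classical
  by_contra! h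
  refine hx ?_
  rw [← DirectSum.sum_support_decompose 𝒜 x, map_sum]
  exact Finset.sum_eq_zero fun g _ => h g _ (SetLike.coe_mem _)

theorem exists_homogeneous_mul_mul_ne_zero (𝒜 : G → Submodule K A) [GradedAlgebra 𝒜]
    (hA : ∀ a b : A, a ≠ 0 → b ≠ 0 → ∃ x, a * x * b ≠ 0) {a b : A} (ha : a ≠ 0) (hb : b ≠ 0) :
    ∃ g, ∃ x ∈ 𝒜 g, a * x * b ≠ 0 := by
  obtain ⟨x, hx⟩ := hA a b ha hb
  exact exists_homogeneous_ne_zero 𝒜 (LinearMap.mulRight K b ∘ₗ LinearMap.mulLeft K a) hx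

/-- A homogeneous element can be solved for by a homogeneous left factor. -/
theorem exists_homogeneous_left_factor (𝒜 : G → Submodule K A) [GradedAlgebra 𝒜] {g h : G}
    {a b x : A} (ha : a ∈ 𝒜 g) (hb : b ∈ 𝒜 (h + g)) (hx : x * b = a) :
    ∃ y ∈ 𝒜 (-h), y * b = a := by
  -- Only the component of `x` of degree `-h` contributes to degree `g` in `x * b`.
  refine ⟨DirectSum.decompose 𝒜 x (-h), SetLike.coe_mem _, ?_⟩
  rw [← DirectSum.coe_decompose_mul_add_of_right_mem 𝒜 hb, hx, neg_add_cancel_left,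
    DirectSum.decompose_of_mem_same 𝒜 ha]

/-- A nonzero homogeneous element generating a minimal graded left ideal. -/
theorem exists_minimal_homogeneous [Nontrivial A] [FiniteDimensional K A]
    (𝒜 : G → Submodule K A) [GradedAlgebra 𝒜] :
    ∃ g, ∃ a ∈ 𝒜 g, a ≠ 0 ∧ ∀ h, ∀ b ∈ 𝒜 h, b * a ≠ 0 → ∃ y ∈ 𝒜 (-h), y * (b * a) = a := by
  classical
  -- The range of `LinearMap.mulRight K a` is the left ideal `A a`; its dimension is minimized over
  -- nonzero homogeneous `a`.
  have hex : ∃ m, ∃ g, ∃ a ∈ 𝒜 g, a ≠ 0 ∧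
      Module.finrank K (LinearMap.range (LinearMap.mulRight K a)) = m :=
    ⟨_, 0, 1, SetLike.GradedOne.one_mem, one_ne_zero, rfl⟩
  obtain ⟨g, a, ha, ha0, hrank⟩ := Nat.find_spec hex
  refine ⟨g, a, ha, ha0, fun h b hb hba => ?_⟩
  have hmem : b * a ∈ 𝒜 (h + g) := SetLike.GradedMul.mul_mem hb ha
  have hle : LinearMap.range (LinearMap.mulRight K (b * a)) ≤
      LinearMap.range (LinearMap.mulRight K a) := by
    rintro _ ⟨x, rfl⟩
    exact ⟨x * b, by simp [mul_assoc]⟩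
  have heq := Submodule.eq_of_le_of_finrank_le hle
    (hrank.trans_le (Nat.find_min' hex ⟨_, _, hmem, hba, rfl⟩))
  have : a ∈ LinearMap.range (LinearMap.mulRight K (b * a)) := heq ▸ ⟨1, by simp⟩
  obtain ⟨x, hx⟩ := this
  exact exists_homogeneous_left_factor 𝒜 ha hmem hx

/-- A graded-prime finite-dimensional graded algebra has an idempotent of degree `0` generating
a minimal graded left ideal. -/
theorem exists_minimal_idempotent [Nontrivial A] [FiniteDimensional K A]
    (𝒜 : G → Submodule K A) [GradedAlgebra 𝒜]
    (hA : ∀ a b : A, a ≠ 0 → b ≠ 0 → ∃ x, a * x * b ≠ 0) :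
    ∃ e ∈ 𝒜 0, e ≠ 0 ∧ e * e = e ∧
      ∀ g, ∀ d ∈ 𝒜 g, d ≠ 0 → d * e = d → ∃ b ∈ 𝒜 (-g), b * d = e := by
  obtain ⟨g, a, ha, ha0, hmin⟩ := exists_minimal_homogeneous 𝒜
  obtain ⟨h, b, hb, hb0⟩ := exists_homogeneous_mul_mul_ne_zero 𝒜 hA ha0 ha0
  obtain ⟨x, hx, hxa⟩ := hmin (g + h) (a * b) (SetLike.GradedMul.mul_mem ha hb) hb0
  have hbx : b * x ∈ 𝒜 (-g) := by
    have := SetLike.GradedMul.mul_mem hb hx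
    rwa [show h + -(g + h) = -g by abel] at this
  have he : b * x * a ∈ 𝒜 0 := by
    have := SetLike.GradedMul.mul_mem hbx ha
    rwa [neg_add_cancel] at this
  -- The idempotent will be `e = b x a`, where `x (a b a) = a`; it fixes `b a` from the left.
  have hec : b * x * a * (b * a) = b * a := by
    rw [show b * x * a * (b * a) = b * (x * (a * b * a)) by simp only [mul_assoc], hxa]
  have hy : b * x * a * (b * x) - b * x ∈ 𝒜 (-g) := by
    refine sub_mem ?_ hbx
    have := SetLike.GradedMul.mul_mem he hbx
    rwa [zero_add] at this
  refine ⟨b * x * a, he, ?_, ?_, ?_⟩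
  · intro h0
    rw [h0, zero_mul] at hec
    exact hb0 (by rw [mul_assoc, ← hec, mul_zero])
  -- If `e² ≠ e`, minimality gives `a = z (e² - e)` for some `z`. But `e² - e` kills `b a`, so `a b
  -- a = 0`, a contradiction.
  · by_contra hne
    obtain ⟨z, -, hz⟩ := hmin _ _ hy (by
      intro h0
      refine hne (sub_eq_zero.1 ?_)
      rw [← h0]
      noncomm_ring)
    refine hb0 ?_
    rw [mul_assoc]
    nth_rw 1 [← hz]
    rw [show z * ((b * x * a * (b * x) - b * x) * a) * (b * a) =
      z * (b * x * a * (b * x * a * (b * a)) - b * x * a * (b * a)) by noncomm_ring, hec, hec,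
      sub_self, mul_zero]
  -- Since `d (b x) a = d e = d ≠ 0`, minimality gives `a = z d`, whence `e = (b x z) d`.
  · intro k d hd hd0 hde
    obtain ⟨z, hz, hzd⟩ := hmin _ (d * (b * x)) (SetLike.GradedMul.mul_mem hd hbx)
      (by rwa [mul_assoc, hde])
    rw [mul_assoc d, hde] at hzd
    refine ⟨b * x * z, ?_, by rw [mul_assoc, hzd]⟩
    have := SetLike.GradedMul.mul_mem hbx hz
    rwa [show -g + -(k + -g) = -k by abel] at this

/-- The component of degree `g` of the corner algebra `e A e`. -/
def cornerComponent (𝒜 : G → Submodule K A) (e : A) (g : G) : Submodule K A where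
  carrier := {d | d ∈ 𝒜 g ∧ e * d = d ∧ d * e = d}
  add_mem' := fun ⟨h1, h2, h3⟩ ⟨h4, h5, h6⟩ =>
    ⟨add_mem h1 h4, by rw [mul_add, h2, h5], by rw [add_mul, h3, h6]⟩
  zero_mem' := ⟨zero_mem _, mul_zero _, zero_mul _⟩
  smul_mem' := fun c x ⟨h1, h2, h3⟩ =>
    ⟨Submodule.smul_mem _ c h1, by rw [mul_smul_comm, h2], by rw [smul_mul_assoc, h3]⟩

theorem mul_mem_cornerComponent (𝒜 : G → Submodule K A) [GradedAlgebra 𝒜] {e x y : A} {g h : G}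
    (hx : x ∈ cornerComponent 𝒜 e g) (hy : y ∈ cornerComponent 𝒜 e h) :
    x * y ∈ cornerComponent 𝒜 e (g + h) :=
  ⟨SetLike.GradedMul.mul_mem hx.1 hy.1, by rw [← mul_assoc, hx.2.1], by rw [mul_assoc, hy.2.2]⟩

theorem corner_mem_cornerComponent (𝒜 : G → Submodule K A) [GradedAlgebra 𝒜] {e x : A} {g : G}
    (he : e ∈ 𝒜 0) (hee : e * e = e) (hx : x ∈ 𝒜 g) :
    e * x * e ∈ cornerComponent 𝒜 e g := by
  refine ⟨?_, by rw [← mul_assoc, ← mul_assoc, hee], by rw [mul_assoc, hee]⟩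
  have := SetLike.GradedMul.mul_mem (SetLike.GradedMul.mul_mem he hx) he
  rwa [zero_add, add_zero] at this

/-- `e A e` is a graded division algebra. -/
theorem exists_inverse_cornerComponent (𝒜 : G → Submodule K A) [GradedAlgebra 𝒜] {e : A}
    (he : e ∈ 𝒜 0) (he0 : e ≠ 0) (hee : e * e = e)
    (hdiv : ∀ g, ∀ d ∈ 𝒜 g, d ≠ 0 → d * e = d → ∃ b ∈ 𝒜 (-g), b * d = e)
    {g : G} {d : A} (hd : d ∈ cornerComponent 𝒜 e g) (hd0 : d ≠ 0) :
    ∃ b ∈ cornerComponent 𝒜 e (-g), b * d = e ∧ d * b = e := by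
  have key : ∀ g, ∀ d ∈ cornerComponent 𝒜 e g, d ≠ 0 →
      ∃ b ∈ cornerComponent 𝒜 e (-g), b * d = e := by
    intro g d hd hd0
    obtain ⟨b, hb, hbd⟩ := hdiv g d hd.1 hd0 hd.2.2
    exact ⟨e * b * e, corner_mem_cornerComponent 𝒜 he hee hb,
      by rw [mul_assoc, hd.2.1, mul_assoc, hbd, hee]⟩
  obtain ⟨b, hb, hbd⟩ := key g d hd hd0
  have hb0 : b ≠ 0 := by
    rintro rfl
    exact he0 (by rw [← hbd, zero_mul])
  -- The left inverse `b` has a left inverse `c` of its own, and `c = c b d = d`.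
  obtain ⟨c, hc, hcb⟩ := key _ b hb hb0
  refine ⟨b, hb, hbd, ?_⟩
  have : c = d := by rw [← hc.2.2, ← hbd, ← mul_assoc, hcb, hd.2.1]
  rw [← this, hcb]

/-- Left multiplication by `d` on the degree 0 part of the corner has an eigenvalue `c`; an
eigenvector is invertible there, and cancelling it from `d x = c x` leaves `d = c e`. -/
theorem eq_smul_of_mem_cornerComponent_zero [IsAlgClosed K] [FiniteDimensional K A]
    (𝒜 : G → Submodule K A) [GradedAlgebra 𝒜] {e : A}
    (he : e ∈ 𝒜 0) (he0 : e ≠ 0) (hee : e * e = e)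
    (hdiv : ∀ g, ∀ d ∈ 𝒜 g, d ≠ 0 → d * e = d → ∃ b ∈ 𝒜 (-g), b * d = e)
    {d : A} (hd : d ∈ cornerComponent 𝒜 e 0) : ∃ c : K, d = c • e := by
  have hemem : e ∈ cornerComponent 𝒜 e 0 := ⟨he, hee, hee⟩
  have hmap : ∀ x ∈ cornerComponent 𝒜 e 0, LinearMap.mulLeft K d x ∈ cornerComponent 𝒜 e 0 := by
    intro x hx
    have := mul_mem_cornerComponent 𝒜 hd hx
    rwa [add_zero] at this
  have : Nontrivial (cornerComponent 𝒜 e 0) :=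
    ⟨⟨e, hemem⟩, 0, fun h => he0 (congrArg Subtype.val h)⟩
  obtain ⟨c, hc⟩ := Module.End.exists_eigenvalue ((LinearMap.mulLeft K d).restrict hmap)
  obtain ⟨⟨x, hx⟩, hxe, hx0⟩ := hc.exists_hasEigenvector
  rw [Module.End.mem_eigenspace_iff] at hxe
  have hdx : d * x = c • x := congrArg Subtype.val hxe
  refine ⟨c, ?_⟩
  obtain ⟨b, -, -, hxb⟩ := exists_inverse_cornerComponent 𝒜 he he0 hee hdiv hx
    (fun h => hx0 (Subtype.ext h))
  rw [← hd.2.2, ← hxb, ← mul_assoc, hdx, smul_mul_assoc]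

/-- Multiplying by the inverse of `d` reduces to degree 0. -/
theorem eq_smul_of_mem_cornerComponent [IsAlgClosed K] [FiniteDimensional K A]
    (𝒜 : G → Submodule K A) [GradedAlgebra 𝒜] {e : A}
    (he : e ∈ 𝒜 0) (he0 : e ≠ 0) (hee : e * e = e)
    (hdiv : ∀ g, ∀ d ∈ 𝒜 g, d ≠ 0 → d * e = d → ∃ b ∈ 𝒜 (-g), b * d = e)
    {g : G} {d x : A} (hd : d ∈ cornerComponent 𝒜 e g) (hd0 : d ≠ 0)
    (hx : x ∈ cornerComponent 𝒜 e g) : ∃ c : K, x = c • d := by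
  obtain ⟨b, hb, hbd, -⟩ := exists_inverse_cornerComponent 𝒜 he he0 hee hdiv hd hd0
  have hxb := mul_mem_cornerComponent 𝒜 hx hb
  rw [add_neg_cancel] at hxb
  obtain ⟨c, hc⟩ := eq_smul_of_mem_cornerComponent_zero 𝒜 he he0 hee hdiv hxb
  exact ⟨c, by rw [← hx.2.2, ← hbd, ← mul_assoc, hc, smul_mul_assoc, hd.2.1]⟩

theorem mul_ne_zero_of_mem_cornerComponent (𝒜 : G → Submodule K A) [GradedAlgebra 𝒜] {e : A}
    (he : e ∈ 𝒜 0) (he0 : e ≠ 0) (hee : e * e = e)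
    (hdiv : ∀ g, ∀ d ∈ 𝒜 g, d ≠ 0 → d * e = d → ∃ b ∈ 𝒜 (-g), b * d = e)
    {g h : G} {x y : A} (hx : x ∈ cornerComponent 𝒜 e g) (hx0 : x ≠ 0)
    (hy : y ∈ cornerComponent 𝒜 e h) (hy0 : y ≠ 0) : x * y ≠ 0 := by
  obtain ⟨b, -, hbx, -⟩ := exists_inverse_cornerComponent 𝒜 he he0 hee hdiv hx hx0
  intro h0
  refine hy0 ?_
  rw [← hy.2.1, ← hbx, mul_assoc, h0, mul_zero]

/-- The corner `e A e` has a basis `X_q`, `q ∈ Q`, multiplying by a 2-cocycle. -/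
theorem exists_twisted_basis_corner [IsAlgClosed K] [FiniteDimensional K A]
    (𝒜 : G → Submodule K A) [GradedAlgebra 𝒜] {e : A}
    (he : e ∈ 𝒜 0) (he0 : e ≠ 0) (hee : e * e = e)
    (hdiv : ∀ g, ∀ d ∈ 𝒜 g, d ≠ 0 → d * e = d → ∃ b ∈ 𝒜 (-g), b * d = e) :
    ∃ (Q : AddSubgroup G) (α : TwoCocycle Q K) (x : Q → A),
      (∀ q : Q, x q ∈ cornerComponent 𝒜 e (q : G)) ∧ (∀ q, x q ≠ 0) ∧
      (∀ p q, x p * x q = (α.toFun p q : K) • x (p + q)) ∧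
      (∀ g, ∀ d ∈ cornerComponent 𝒜 e g, d ≠ 0 → ∃ q : Q, (q : G) = g ∧ ∃ c : K, d = c • x q) := by
  classical
  -- The support of the corner is a subgroup because nonzero homogeneous elements are invertible.
  let Q : AddSubgroup G :=
    { carrier := {g | ∃ d ∈ cornerComponent 𝒜 e g, d ≠ 0}
      add_mem' := fun ⟨x, hx, hx0⟩ ⟨y, hy, hy0⟩ => ⟨x * y, mul_mem_cornerComponent 𝒜 hx hy,
        mul_ne_zero_of_mem_cornerComponent 𝒜 he he0 hee hdiv hx hx0 hy hy0⟩
      zero_mem' := ⟨e, ⟨he, hee, hee⟩, he0⟩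
      neg_mem' := fun ⟨x, hx, hx0⟩ => by
        obtain ⟨b, hb, hbx, -⟩ := exists_inverse_cornerComponent 𝒜 he he0 hee hdiv hx hx0
        refine ⟨b, hb, ?_⟩
        rintro rfl
        exact he0 (by rw [← hbx, zero_mul]) }
  have hQ : ∀ q : Q, ∃ d ∈ cornerComponent 𝒜 e (q : G), d ≠ 0 := fun q => q.2
  choose x hx hx0 using hQ
  have hmul : ∀ p q : Q, ∃ c : K, x p * x q = c • x (p + q) := fun p q =>
    eq_smul_of_mem_cornerComponent 𝒜 he he0 hee hdiv (hx (p + q)) (hx0 _)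
      (mul_mem_cornerComponent 𝒜 (hx p) (hx q))
  choose c hc using hmul
  have hc0 : ∀ p q, c p q ≠ 0 := fun p q h0 =>
    mul_ne_zero_of_mem_cornerComponent 𝒜 he he0 hee hdiv (hx p) (hx0 p) (hx q) (hx0 q)
      (by rw [hc, h0, zero_smul])
  let α : TwoCocycle Q K :=
    { toFun := fun p q => Units.mk0 (c p q) (hc0 p q)
      cocycle := fun a b d => by
        ext
        simp only [Units.val_mul, Units.val_mk0]
        have h := mul_assoc (x a) (x b) (x d)
        rw [hc, hc, smul_mul_assoc, mul_smul_comm, hc, hc, smul_smul, smul_smul, add_assoc] at h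
        exact smul_left_injective K (hx0 _) h }
  exact ⟨Q, α, x, hx, hx0, hc, fun g d hd hd0 => ⟨⟨g, d, hd, hd0⟩, rfl,
    eq_smul_of_mem_cornerComponent 𝒜 he he0 hee hdiv (hx ⟨g, d, hd, hd0⟩) (hx0 _) hd⟩⟩

/-- A homogeneous basis of `A e` over `e A e` with its dual basis. -/
theorem exists_homogeneous_frame [FiniteDimensional K A]
    (𝒜 : G → Submodule K A) [GradedAlgebra 𝒜]
    (hA : ∀ a b : A, a ≠ 0 → b ≠ 0 → ∃ x, a * x * b ≠ 0) {e : A}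
    (he : e ∈ 𝒜 0) (he0 : e ≠ 0) (hee : e * e = e)
    (hdiv : ∀ g, ∀ d ∈ 𝒜 g, d ≠ 0 → d * e = d → ∃ b ∈ 𝒜 (-g), b * d = e) :
    ∃ (r : ℕ) (s : Fin r → G) (u w : Fin r → A), (∀ i, u i ∈ 𝒜 (s i)) ∧ (∀ i, w i ∈ 𝒜 (-s i)) ∧
      (∀ i, u i * e = u i) ∧ (∀ i, e * w i = w i) ∧
      (∀ j i, w j * u i = if j = i then e else 0) ∧ ∑ i, u i * w i = 1 := by
  classical
  let P : ℕ → Prop := fun r => ∃ (s : Fin r → G) (u w : Fin r → A),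
    (∀ i, u i ∈ 𝒜 (s i)) ∧ (∀ i, w i ∈ 𝒜 (-s i)) ∧
      (∀ i, u i * e = u i) ∧ (∀ i, e * w i = w i) ∧ (∀ j i, w j * u i = if j = i then e else 0)
  -- Pairing with the `w i` shows the `u i` linearly independent, so a partial frame of maximal size
  -- exists.
  have hbound : ∀ r, P r → r ≤ Module.finrank K A := by
    rintro r ⟨s, u, w, -, -, hu, -, hwu⟩
    have hli : LinearIndependent K u := by
      rw [Fintype.linearIndependent_iff]
      intro c hc i
      have h := congrArg (w i * ·) hc
      simp only [Finset.mul_sum, mul_smul_comm, hwu, smul_ite, smul_zero, Finset.sum_ite_eq,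
        Finset.mem_univ, if_true, mul_zero] at h
      exact (smul_eq_zero.1 h).resolve_right he0
    simpa using hli.fintype_card_le_finrank
  have hP0 : P 0 := ⟨Fin.elim0, Fin.elim0, Fin.elim0, fun i => i.elim0, fun i => i.elim0,
    fun i => i.elim0, fun i => i.elim0, fun i => i.elim0⟩
  obtain ⟨r, ⟨s, u, w, hu, hw, hue, hew, hwu⟩, hmax⟩ : ∃ r, P r ∧ ¬ P (r + 1) := by
    by_contra! h
    exact absurd (hbound _ (Nat.rec (motive := P) hP0 h (Module.finrank K A + 1))) (by omega)
  refine ⟨r, s, u, w, hu, hw, hue, hew, hwu, ?_⟩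
  by_contra hne
  -- If this complementary idempotent is nonzero, primeness gives a nonzero homogeneous element of
  -- `p A e`; together with its left inverse it enlarges the frame.
  set p : A := 1 - ∑ i, u i * w i with hp
  have hp0 : p ≠ 0 := fun h => hne (sub_eq_zero.1 h).symm
  have hpu : ∀ i, p * u i = 0 := by
    intro i
    simp [hp, sub_mul, Finset.sum_mul, mul_assoc, hwu, hue]
  have hwp : ∀ i, w i * p = 0 := by
    intro i
    simp [hp, mul_sub, Finset.mul_sum, ← mul_assoc, hwu, hew]
  have hpp : p * p = p := by
    nth_rw 2 [hp]
    rw [mul_sub, Finset.mul_sum]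
    simp [← mul_assoc, hpu]
  have hpmem : p ∈ 𝒜 0 := by
    refine sub_mem SetLike.GradedOne.one_mem (sum_mem fun i _ => ?_)
    have := SetLike.GradedMul.mul_mem (hu i) (hw i)
    rwa [add_neg_cancel] at this
  obtain ⟨g, a, ha, hpa⟩ := exists_homogeneous_mul_mul_ne_zero 𝒜 hA hp0 he0
  have hv : p * a * e ∈ 𝒜 g := by
    have := SetLike.GradedMul.mul_mem (SetLike.GradedMul.mul_mem hpmem ha) he
    rwa [zero_add, add_zero] at this
  obtain ⟨b, hb, hbv⟩ := hdiv g _ hv hpa (by rw [mul_assoc, hee])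
  have hpv : p * (p * a * e) = p * a * e := by rw [← mul_assoc, ← mul_assoc, hpp]
  have hw' : e * b * p ∈ 𝒜 (-g) := by
    have := SetLike.GradedMul.mul_mem (SetLike.GradedMul.mul_mem he hb) hpmem
    rwa [zero_add, add_zero] at this
  refine hmax ⟨Fin.cons g s, Fin.cons (p * a * e) u, Fin.cons (e * b * p) w, ?_, ?_, ?_, ?_, ?_⟩
  · exact Fin.cases hv hu
  · exact Fin.cases hw' hw
  · exact Fin.cases (by simp [mul_assoc, hee]) hue
  · exact Fin.cases (by simp [← mul_assoc, hee]) hew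
  · refine Fin.cases (Fin.cases ?_ fun i => ?_) fun j => Fin.cases ?_ fun i => ?_
    · simp only [Fin.cons_zero, if_true]
      rw [mul_assoc (e * b), hpv, mul_assoc, hbv, hee]
    · simp [mul_assoc, hpu, (Fin.succ_ne_zero i).symm]
    · simp [← mul_assoc, hwp]
    · simp [hwu]

end GradedPrime

/-! ### Maps out of a twisted group algebra. -/

namespace TwistedGroupAlgebra

variable {Q K A : Type*} [AddCommGroup Q] [Field K] (α : TwoCocycle Q K)

/-- The linear map sending the canonical basis to a given family. -/
noncomputable def liftLinear [AddCommGroup A] [Module K A] (x : Q → A) :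
    TwistedGroupAlgebra α →ₗ[K] A :=
  (Finsupp.linearCombination K x : (Q →₀ K) →ₗ[K] A)

theorem liftLinear_X [AddCommGroup A] [Module K A] (x : Q → A) (q : Q) :
    liftLinear α x (X α q) = x q := by
  unfold liftLinear X
  erw [Finsupp.linearCombination_single, one_smul]

theorem liftLinear_injective [AddCommGroup A] [Module K A] {x : Q → A}
    (hx : LinearIndependent K x) : Function.Injective (liftLinear α x) := hx

theorem liftLinear_mul [Ring A] [Algebra K A] {x : Q → A}
    (hx : ∀ p q, x p * x q = (α.toFun p q : K) • x (p + q)) (y z : TwistedGroupAlgebra α) :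
    liftLinear α x (y * z) = liftLinear α x y * liftLinear α x z := by
  induction y using induction_X with
  | h0 => simp
  | hadd y y' h h' => simp [add_mul, h, h']
  | hX c a =>
    induction z using induction_X with
    | h0 => simp
    | hadd z z' h h' => simp only [mul_add, map_add, h, h']
    | hX d b =>
      simp only [smul_mul_assoc, mul_smul_comm, map_smul, X_mul_X, liftLinear_X, hx]

end TwistedGroupAlgebra

/-! ### Invariance of the primeness property under graded isomorphism. -/

section GradedIsomorphic

variable {K G A B C : Type*} [Field K] [Ring A] [Algebra K A] [Ring B]
  [Algebra K B] [Ring C] [Algebra K C]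

theorem GradedIsomorphic.symm {𝒜 : G → Submodule K A} {ℬ : G → Submodule K B}
    (h : GradedIsomorphic 𝒜 ℬ) : GradedIsomorphic ℬ 𝒜 := by
  obtain ⟨φ, hφ⟩ := h
  refine ⟨φ.symm, fun g => ?_⟩
  rw [← hφ g, ← Submodule.map_comp]
  convert Submodule.map_id _
  ext
  simp

theorem GradedIsomorphic.trans {𝒜 : G → Submodule K A} {ℬ : G → Submodule K B}
    {𝒞 : G → Submodule K C} (h : GradedIsomorphic 𝒜 ℬ) (h' : GradedIsomorphic ℬ 𝒞) :
    GradedIsomorphic 𝒜 𝒞 := by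
  obtain ⟨φ, hφ⟩ := h
  obtain ⟨ψ, hψ⟩ := h'
  refine ⟨φ.trans ψ, fun g => ?_⟩
  rw [← hψ g, ← hφ g, ← Submodule.map_comp]
  rfl

theorem AlgEquiv.map_lift_freeAlgebra {X : Type*} (φ : A ≃ₐ[K] B) (a : X → A)
    (f : FreeAlgebra K X) : φ (FreeAlgebra.lift K a f) = FreeAlgebra.lift K (φ ∘ a) f := by
  have : (φ : A →ₐ[K] B).comp (FreeAlgebra.lift K a) = FreeAlgebra.lift K (φ ∘ a) := by
    ext; simp
  exact DFunLike.congr_fun this f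

theorem GradedIsomorphic.isGradedCentral {𝒜 : G → Submodule K A} {ℬ : G → Submodule K B}
    (h : GradedIsomorphic 𝒜 ℬ) {f : GradedPolynomial K G} (hf : IsGradedCentral ℬ f) :
    IsGradedCentral 𝒜 f := by
  obtain ⟨φ, hφ⟩ := h
  intro a ha
  have hc := hf (φ ∘ a) fun v => hφ v.1 ▸ ⟨a v, ha v, rfl⟩
  rw [← φ.map_lift_freeAlgebra, Subalgebra.mem_center_iff] at hc
  rw [Subalgebra.mem_center_iff]
  intro b
  apply φ.injective
  rw [map_mul, map_mul, hc]

theorem GradedIsomorphic.isGradedIdentity {𝒜 : G → Submodule K A} {ℬ : G → Submodule K B}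
    (h : GradedIsomorphic 𝒜 ℬ) {f : GradedPolynomial K G} (hf : IsGradedIdentity ℬ f) :
    IsGradedIdentity 𝒜 f := by
  obtain ⟨φ, hφ⟩ := h
  intro a ha
  have hc := hf (φ ∘ a) fun v => hφ v.1 ▸ ⟨a v, ha v, rfl⟩
  rw [← φ.map_lift_freeAlgebra] at hc
  exact (map_eq_zero_iff φ φ.injective).1 hc

theorem GradedIsomorphic.isProperGradedCentral {𝒜 : G → Submodule K A} {ℬ : G → Submodule K B}
    (h : GradedIsomorphic 𝒜 ℬ) {f : GradedPolynomial K G} (hf : IsProperGradedCentral ℬ f) :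
    IsProperGradedCentral 𝒜 f :=
  ⟨h.isGradedCentral hf.1, fun hid => hf.2 (h.symm.isGradedIdentity hid)⟩

theorem GradedIsomorphic.hasPrimenessProperty {𝒜 : G → Submodule K A} {ℬ : G → Submodule K B}
    (h : GradedIsomorphic 𝒜 ℬ) (hℬ : HasPrimenessProperty ℬ) : HasPrimenessProperty 𝒜 :=
  fun S T f g hST hf hg hfg =>
    let ⟨h1, h2⟩ := hℬ S T f g hST hf hg (h.symm.isProperGradedCentral hfg)
    ⟨h.isProperGradedCentral h1, h.isProperGradedCentral h2⟩

theorem GradedIsomorphic.hasPrimenessProperty_iff {𝒜 : G → Submodule K A}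
    {ℬ : G → Submodule K B} (h : GradedIsomorphic 𝒜 ℬ) :
    HasPrimenessProperty 𝒜 ↔ HasPrimenessProperty ℬ :=
  ⟨h.symm.hasPrimenessProperty, h.hasPrimenessProperty⟩

end GradedIsomorphic

/-! ### Graded matrix algebras as tensor products. -/

section Structure

variable {K G A : Type*} [Field K] [AddCommGroup G] [Ring A] [Algebra K A]

/-- The algebra map `K^α Q ⊗ M_r(K) → A` determined by a frame over a corner isomorphic to
`K^α Q`. -/
noncomputable def frameMap {Q : AddSubgroup G} (α : TwoCocycle Q K) (x : Q → A) {r : ℕ}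
    (u w : Fin r → A) : TwistedGroupAlgebra α ⊗[K] Matrix (Fin r) (Fin r) K →ₗ[K] A :=
  TensorProduct.lift (LinearMap.mk₂ K
    (fun y m => ∑ i, ∑ j, m i j • (u i * TwistedGroupAlgebra.liftLinear α x y * w j))
    (fun y z m => by simp [mul_add, add_mul, Finset.sum_add_distrib])
    (fun c y m => by simp [Finset.smul_sum, smul_comm c])
    (fun y m m' => by simp [add_smul, Finset.sum_add_distrib])
    (fun c y m => by simp [Finset.smul_sum, smul_smul]))

theorem frameMap_tmul {Q : AddSubgroup G} (α : TwoCocycle Q K) (x : Q → A) {r : ℕ}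
    (u w : Fin r → A) (y : TwistedGroupAlgebra α) (m : Matrix (Fin r) (Fin r) K) :
    frameMap α x u w (y ⊗ₜ m) =
      ∑ i, ∑ j, m i j • (u i * TwistedGroupAlgebra.liftLinear α x y * w j) := rfl

theorem frameMap_tmul_single {Q : AddSubgroup G} (α : TwoCocycle Q K) (x : Q → A) {r : ℕ}
    (u w : Fin r → A) (y : TwistedGroupAlgebra α) (i j : Fin r) :
    frameMap α x u w (y ⊗ₜ Matrix.single i j 1) =
      u i * TwistedGroupAlgebra.liftLinear α x y * w j := by
  rw [frameMap_tmul, Finset.sum_eq_single i, Finset.sum_eq_single j]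
  · simp
  · intro b _ hb; simp [hb.symm]
  · simp
  · intro b _ hb; simp [hb.symm]
  · simp

/-- The isomorphism sends `X_q ⊗ e_{i,j}` to `u i * x q * w j`, and its inverse reads off the matrix
of corner elements `w i * a * u j`. The tuple is `-s` because `u i * w j` has degree `s i - s j`,
while the convention for `e_{i,j}` is `t j - t i`. -/
theorem gradedIsomorphic_tensorGrading_of_frame [DecidableEq G]
    (𝒜 : G → Submodule K A) [GradedAlgebra 𝒜]
    {e : A} (he : e ∈ 𝒜 0) (hee : e * e = e)
    {Q : AddSubgroup G} {α : TwoCocycle Q K} {x : Q → A}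
    (hx : ∀ q : Q, x q ∈ cornerComponent 𝒜 e (q : G)) (hx0 : ∀ q, x q ≠ 0)
    (hxx : ∀ p q, x p * x q = (α.toFun p q : K) • x (p + q))
    (hspan : ∀ g, ∀ d ∈ cornerComponent 𝒜 e g, d ≠ 0 →
      ∃ q : Q, (q : G) = g ∧ ∃ c : K, d = c • x q)
    {r : ℕ} {s : Fin r → G} {u w : Fin r → A} (hu : ∀ i, u i ∈ 𝒜 (s i))
    (hw : ∀ i, w i ∈ 𝒜 (-s i)) (hue : ∀ i, u i * e = u i) (hew : ∀ i, e * w i = w i)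
    (hwu : ∀ j i, w j * u i = if j = i then e else 0) (huw : ∑ i, u i * w i = 1) :
    GradedIsomorphic 𝒜 (tensorGrading α fun i => -s i) := by
  classical
  set δ := TwistedGroupAlgebra.liftLinear α x with hδ
  have hli : LinearIndependent K x := by
    have := (DirectSum.Decomposition.isInternal 𝒜).submodule_iSupIndep
    exact (this.comp Subtype.val_injective).linearIndependent _ (fun q => (hx q).1) hx0
  obtain ⟨ε, hε⟩ := LinearMap.exists_leftInverse_of_injective δ
    (LinearMap.ker_eq_bot.2 (TwistedGroupAlgebra.liftLinear_injective α hli))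
  have hεδ : ∀ y, ε (δ y) = y := fun y => DFunLike.congr_fun hε y
  have hδX : ∀ q, δ (TwistedGroupAlgebra.X α q) = x q := TwistedGroupAlgebra.liftLinear_X α x
  have hδmul : ∀ y z, δ (y * z) = δ y * δ z := TwistedGroupAlgebra.liftLinear_mul α hxx
  have heδ : ∀ y, e * δ y = δ y := by
    intro y
    induction y using TwistedGroupAlgebra.induction_X with
    | h0 => simp
    | hadd y z h h' => simp [mul_add, h, h']
    | hX c a => simp [hδX, (hx a).2.1]
  have hδe : ∀ y, δ y * e = δ y := by
    intro y
    induction y using TwistedGroupAlgebra.induction_X with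
    | h0 => simp
    | hadd y z h h' => simp [add_mul, h, h']
    | hX c a => simp [hδX, (hx a).2.2]
  have hcomp : ∀ g, ∀ d ∈ cornerComponent 𝒜 e g, δ (ε d) = d := by
    intro g d hd
    by_cases hd0 : d = 0
    · simp [hd0]
    · obtain ⟨q, -, c, rfl⟩ := hspan g d hd hd0
      rw [← hδX, ← map_smul, hεδ]
  have hcorner : ∀ a, δ (ε (e * a * e)) = e * a * e := by
    intro a
    rw [← DirectSum.sum_support_decompose 𝒜 a, Finset.mul_sum, Finset.sum_mul, map_sum, map_sum]
    exact Finset.sum_congr rfl fun g _ =>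
      hcomp g _ (corner_mem_cornerComponent 𝒜 he hee (SetLike.coe_mem _))
  -- Since `e` lies in the image of the multiplicative map `δ`, the image of 1 acts as the identity
  -- on `e`.
  have hδ1 : δ 1 = e := by
    have h1 : δ (ε e) = e := by simpa [hee] using hcorner e
    have h2 := hδmul 1 (ε e)
    rw [one_mul, h1, hδe] at h2
    exact h2.symm
  let F := frameMap α x u w
  let ψ : TwistedGroupAlgebra α ⊗[K] Matrix (Fin r) (Fin r) K →ₐ[K] A :=
    Algebra.TensorProduct.algHomOfLinearMapTensorProduct F
      (fun y z m m' => by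
        simp only [F, frameMap_tmul, ← hδ, hδmul]
        have key : ∀ i k l j, (u i * δ y * w k) * (u l * δ z * w j) =
            if k = l then u i * (δ y * δ z) * w j else 0 := by
          intro i k l j
          rw [show (u i * δ y * w k) * (u l * δ z * w j) =
            u i * δ y * (w k * u l) * δ z * w j by simp only [mul_assoc], hwu]
          split_ifs
          · rw [mul_assoc (u i), hδe, mul_assoc (u i)]
          · simp
        simp only [Matrix.mul_apply, Finset.sum_smul]
        rw [Finset.sum_mul]
        refine Finset.sum_congr rfl fun i _ => ?_
        rw [Finset.sum_mul, Finset.sum_comm]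
        refine Finset.sum_congr rfl fun k _ => ?_
        simp only [Finset.mul_sum, smul_mul_smul_comm, key, smul_ite, smul_zero]
        rw [Finset.sum_comm]
        simp only [Finset.sum_ite_eq, Finset.mem_univ, if_true])
      (by
        simp only [F, frameMap_tmul, ← hδ, hδ1, hue, Matrix.one_apply, ite_smul, one_smul,
          zero_smul, Finset.sum_ite_eq, Finset.mem_univ, if_true]
        exact huw)
  have hψ : ∀ z, ψ z = F z := fun z => rfl
  let I : A →ₗ[K] TwistedGroupAlgebra α ⊗[K] Matrix (Fin r) (Fin r) K :=
    ∑ i, ∑ j, ((TensorProduct.mk K (TwistedGroupAlgebra α) _).flip (Matrix.single i j 1)) ∘ₗ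
      ε ∘ₗ LinearMap.mulLeft K (w i) ∘ₗ LinearMap.mulRight K (u j)
  have hI : ∀ a, I a = ∑ i, ∑ j, ε (w i * (a * u j)) ⊗ₜ[K] Matrix.single i j (1 : K) := by
    intro a
    simp [I]
  have hFI : ∀ a, F (I a) = a := by
    intro a
    simp only [hI, map_sum]
    simp only [F, frameMap_tmul_single, ← hδ]
    have : ∀ i j, δ (ε (w i * (a * u j))) = w i * (a * u j) := by
      intro i j
      have := hcorner (w i * (a * u j))
      rwa [← mul_assoc e, hew, mul_assoc, mul_assoc a, hue] at this
    simp only [this]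
    calc ∑ i, ∑ j, u i * (w i * (a * u j)) * w j = (∑ i, u i * w i) * a * ∑ j, u j * w j := by
          rw [Finset.sum_mul, Finset.sum_mul]
          simp only [Finset.mul_sum, mul_assoc]
      _ = a := by rw [huw, one_mul, mul_one]
  have hIF : I ∘ₗ F = LinearMap.id := by
    refine TensorProduct.ext' fun y m => ?_
    simp only [LinearMap.comp_apply, LinearMap.id_apply, hI]
    have : ∀ i j, ε (w i * (F (y ⊗ₜ m) * u j)) = m i j • y := by
      intro i j
      have : w i * (F (y ⊗ₜ m) * u j) = m i j • δ y := by
        simp only [F, frameMap_tmul, ← hδ, Finset.sum_mul, Finset.mul_sum, smul_mul_assoc,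
          mul_smul_comm, mul_assoc, hwu, mul_ite, mul_zero, smul_ite, smul_zero,
          Finset.sum_ite_eq', Finset.mem_univ, if_true]
        simp only [← mul_assoc, hwu, ite_mul, zero_mul, smul_ite, smul_zero,
          Finset.sum_ite_eq, Finset.mem_univ, if_true, heδ, hδe]
      rw [this, map_smul, hεδ]
    simp only [this]
    conv_rhs => rw [Matrix.matrix_eq_sum_single m]
    simp only [TensorProduct.tmul_sum, TensorProduct.smul_tmul, Matrix.smul_single, smul_eq_mul,
      mul_one]
  have hbij : Function.Bijective ψ :=
    ⟨fun a b hab => by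
      have := congrArg I hab
      rwa [hψ, hψ, ← LinearMap.comp_apply, ← LinearMap.comp_apply, hIF] at this,
    fun a => ⟨I a, hFI a⟩⟩
  refine GradedIsomorphic.symm ⟨AlgEquiv.ofBijective ψ hbij, fun g => le_antisymm ?_ ?_⟩
  · rw [Submodule.map_le_iff_le_comap, tensorGrading, Submodule.span_le]
    rintro _ ⟨q, i, j, rfl, rfl⟩
    change F _ ∈ 𝒜 _
    simp only [F, frameMap_tmul_single, ← hδ, hδX]
    have := SetLike.GradedMul.mul_mem (SetLike.GradedMul.mul_mem (hu i) (hx q).1) (hw j)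
    rwa [show s i + (q : G) + -s j = (q : G) + (-s j - -s i) by abel] at this
  · intro a ha
    refine ⟨I a, ?_, hFI a⟩
    rw [hI]
    refine sum_mem fun i _ => sum_mem fun j _ => ?_
    have hd : w i * (a * u j) ∈ cornerComponent 𝒜 e (-s i + (g + s j)) :=
      ⟨SetLike.GradedMul.mul_mem (hw i) (SetLike.GradedMul.mul_mem ha (hu j)),
        by rw [← mul_assoc, hew], by rw [mul_assoc, mul_assoc, hue]⟩
    by_cases hd0 : w i * (a * u j) = 0
    · rw [hd0, map_zero, TensorProduct.zero_tmul]
      exact zero_mem _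
    · obtain ⟨q, hq, c, hc⟩ := hspan _ _ hd hd0
      rw [hc, ← hδX, ← map_smul, hεδ, ← TensorProduct.smul_tmul']
      exact Submodule.smul_mem _ _ (Submodule.subset_span ⟨q, i, j,
        show (q : G) + (-s j - -s i) = g by rw [hq]; abel, rfl⟩)

theorem exists_gradedIsomorphic_tensorGrading [DecidableEq G] [IsAlgClosed K]
    [Nontrivial A] [FiniteDimensional K A] (𝒜 : G → Submodule K A) [GradedAlgebra 𝒜]
    (hA : ∀ a b : A, a ≠ 0 → b ≠ 0 → ∃ x, a * x * b ≠ 0) :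
    ∃ (Q : AddSubgroup G) (α : TwoCocycle Q K) (r : ℕ) (t : Fin r → G),
      0 < r ∧ GradedIsomorphic 𝒜 (tensorGrading α t) := by
  obtain ⟨e, he, he0, hee, hdiv⟩ := exists_minimal_idempotent 𝒜 hA
  obtain ⟨Q, α, x, hx, hx0, hxx, hspan⟩ := exists_twisted_basis_corner 𝒜 he he0 hee hdiv
  obtain ⟨r, s, u, w, hu, hw, hue, hew, hwu, huw⟩ :=
    exists_homogeneous_frame 𝒜 hA he he0 hee hdiv
  refine ⟨Q, α, r, _, Nat.pos_of_ne_zero ?_, gradedIsomorphic_tensorGrading_of_frame 𝒜 he hee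
    hx hx0 hxx hspan hu hw hue hew hwu huw⟩
  rintro rfl
  simp at huw

theorem Matrix.exists_mul_mul_ne_zero {n : ℕ} (a b : Matrix (Fin n) (Fin n) K) (ha : a ≠ 0)
    (hb : b ≠ 0) : ∃ x, a * x * b ≠ 0 := by
  obtain ⟨i, j, hij⟩ : ∃ i j, a i j ≠ 0 := by
    by_contra! h; exact ha (Matrix.ext h)
  obtain ⟨k, l, hkl⟩ : ∃ k l, b k l ≠ 0 := by
    by_contra! h; exact hb (Matrix.ext h)
  refine ⟨Matrix.single j k 1, fun h => mul_ne_zero hij hkl ?_⟩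
  have := congrFun (congrFun h i) l
  simpa [Matrix.mul_apply, Matrix.single_apply, Finset.sum_ite, ite_and] using this

end Structure

/-! ### The case of a trivial bicharacter. -/

section TrivialBicharacter

variable {K G : Type*} [Field K] [AddCommGroup G]

theorem TwistedGroupAlgebra.mul_comm_of_hasTrivialBicharacter {Q : Type*} [AddCommGroup Q]
    {α : TwoCocycle Q K} (hα : α.HasTrivialBicharacter) (x y : TwistedGroupAlgebra α) :
    x * y = y * x := by
  induction x using induction_X with
  | h0 => simp
  | hadd x x' h h' => rw [add_mul, mul_add, h, h']
  | hX c a =>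
    induction y using induction_X with
    | h0 => simp
    | hadd y y' h h' => rw [add_mul, mul_add, h, h']
    | hX d b =>
      have h : α.toFun a b = α.toFun b a := by
        have := hα a b
        rwa [TwoCocycle.bicharacter, mul_inv_eq_one] at this
      simp only [smul_mul_assoc, mul_smul_comm, X_mul_X, h, add_comm b a, smul_comm c d]

/-- A central simple tensor product `K^α Q ⊗ M_r(K)` with commutative `K^α Q` has trivial `Q`. -/
theorem subsingleton_of_hasTrivialBicharacter {n : ℕ} {Q : AddSubgroup G} {α : TwoCocycle Q K}
    (hα : α.HasTrivialBicharacter) {r : ℕ} (hr : 0 < r)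
    (φ : Matrix (Fin n) (Fin n) K ≃ₐ[K] TwistedGroupAlgebra α ⊗[K] Matrix (Fin r) (Fin r) K) :
    Subsingleton Q := by
  have : Nonempty (Fin r) := ⟨⟨0, hr⟩⟩
  have hscalar : ∀ y : TwistedGroupAlgebra α, ∃ c : K, y = c • 1 := by
    intro y
    -- Commutativity of `K^α Q` makes `y ⊗ 1` central, and the centre of a matrix algebra is `K`.
    have hc : φ.symm (y ⊗ₜ 1) ∈ Subalgebra.center K (Matrix (Fin n) (Fin n) K) := by
      rw [Subalgebra.mem_center_iff]
      intro b
      apply φ.injective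
      rw [map_mul, map_mul, AlgEquiv.apply_symm_apply]
      generalize φ b = z
      induction z using TensorProduct.induction_on with
      | zero => simp
      | add z z' h h' => rw [add_mul, mul_add, h, h']
      | tmul z m =>
        rw [Algebra.TensorProduct.tmul_mul_tmul, Algebra.TensorProduct.tmul_mul_tmul, one_mul,
          mul_one, TwistedGroupAlgebra.mul_comm_of_hasTrivialBicharacter hα]
    rw [Algebra.IsCentral.center_eq_bot, Algebra.mem_bot] at hc
    obtain ⟨c, hc⟩ := hc
    refine ⟨c, ?_⟩
    have h := congrArg φ hc
    rw [AlgEquiv.apply_symm_apply, AlgEquiv.commutes, Algebra.algebraMap_eq_smul_one,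
      Algebra.TensorProduct.one_def, TensorProduct.smul_tmul'] at h
    have hinj := Algebra.TensorProduct.includeLeft_injective (R := K) (S := K)
      (A := TwistedGroupAlgebra α) (B := Matrix (Fin r) (Fin r) K)
      (FaithfulSMul.algebraMap_injective K _)
    exact hinj h.symm
  refine subsingleton_of_forall_eq 0 fun q => ?_
  by_contra hq
  obtain ⟨c, hc⟩ := hscalar (TwistedGroupAlgebra.X α q)
  rw [TwistedGroupAlgebra.one_def, smul_smul] at hc
  have h : (Finsupp.single q 1 : Q →₀ K) =
      (c * ((α.toFun 0 0)⁻¹ : Kˣ)) • (Finsupp.single (0 : Q) (1 : K) : Q →₀ K) := hc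
  have := DFunLike.congr_fun h q
  simp [Ne.symm hq] at this

/-- For trivial `Q` the first factor is the line `K X_0`. The cocycle need not be normalized, so
`X_0` is `α(0,0)` times the unit. -/
theorem gradedIsomorphic_elementaryGrading {Q : AddSubgroup G} [Subsingleton Q]
    (α : TwoCocycle Q K) {r : ℕ} (t : Fin r → G) :
    GradedIsomorphic (tensorGrading α t) (elementaryGrading K t) := by
  have hX : TwistedGroupAlgebra.X α 0 = algebraMap K _ (α.toFun 0 0 : K) := by
    rw [Algebra.algebraMap_eq_smul_one, TwistedGroupAlgebra.one_def, smul_smul, Units.mul_inv,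
      one_smul]
  have : Nontrivial (TwistedGroupAlgebra α) := inferInstanceAs (Nontrivial (Q →₀ K))
  have hbij : Function.Bijective (Algebra.ofId K (TwistedGroupAlgebra α)) := by
    refine ⟨(Algebra.ofId K _).toRingHom.injective, fun y => ?_⟩
    induction y using TwistedGroupAlgebra.induction_X with
    | h0 => exact ⟨0, map_zero _⟩
    | hadd y z h h' =>
      obtain ⟨a, rfl⟩ := h
      obtain ⟨b, rfl⟩ := h'
      exact ⟨a + b, map_add _ _ _⟩
    | hX c q =>
      refine ⟨c * α.toFun 0 0, ?_⟩
      rw [Subsingleton.elim q 0, hX, map_mul, Algebra.smul_def]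
      rfl
  let φ : Matrix (Fin r) (Fin r) K ≃ₐ[K] TwistedGroupAlgebra α ⊗[K] Matrix (Fin r) (Fin r) K :=
    (Algebra.TensorProduct.lid K _).symm.trans
      (Algebra.TensorProduct.congr (AlgEquiv.ofBijective _ hbij) AlgEquiv.refl)
  have hφ : ∀ m, φ m = 1 ⊗ₜ m := by
    intro m
    simp [φ]
  refine GradedIsomorphic.symm ⟨φ, fun g => le_antisymm ?_ ?_⟩
  · rw [Submodule.map_le_iff_le_comap, elementaryGrading, Submodule.span_le]
    rintro _ ⟨i, j, hij, rfl⟩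
    change φ _ ∈ tensorGrading α t g
    rw [hφ, TwistedGroupAlgebra.one_def, ← TensorProduct.smul_tmul']
    exact Submodule.smul_mem _ _ (Submodule.subset_span ⟨0, i, j, by simpa using hij, rfl⟩)
  · rw [tensorGrading, Submodule.span_le]
    rintro _ ⟨q, i, j, hij, rfl⟩
    obtain rfl := Subsingleton.elim q 0
    refine ⟨(α.toFun 0 0 : K) • Matrix.single i j 1,
      Submodule.smul_mem _ _ (Submodule.subset_span ⟨i, j, by simpa using hij, rfl⟩), ?_⟩
    change φ _ = _
    rw [hφ, hX, Algebra.algebraMap_eq_smul_one, TensorProduct.smul_tmul]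

end TrivialBicharacter

/-! ### Capelli polynomials and their traces. -/

section Capelli

open Equiv

/-- The cyclic rotation of the Capelli polynomial in `x` and `y` with `x 0` brought to the front
and removed. -/
def capelliDual {m : ℕ} {R : Type*} [Ring R] (x y : Fin (m + 1) → R) : R :=
  ∑ σ : Perm (Fin (m + 1)), (Perm.sign σ : ℤ) •
    (y (σ.symm 0) *
      (((List.finRange (m + 1)).drop (σ.symm 0 + 1)).map fun j => x (σ j) * y j).prod *
      (((List.finRange (m + 1)).take (σ.symm 0)).map fun j => x (σ j) * y j).prod)

theorem map_capelliDual {m : ℕ} {R S F : Type*} [Ring R] [Ring S] [FunLike F R S]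
    [RingHomClass F R S] (φ : F) (x y : Fin (m + 1) → R) :
    φ (capelliDual x y) = capelliDual (φ ∘ x) (φ ∘ y) := by
  simp [capelliDual, map_list_prod, Function.comp_def]

theorem List.finRange_split {m : ℕ} (k : Fin (m + 1)) :
    List.finRange (m + 1) =
      (List.finRange (m + 1)).take k ++ k :: (List.finRange (m + 1)).drop (k + 1) := by
  have hk : (k : ℕ) < (List.finRange (m + 1)).length := by rw [List.length_finRange]; exact k.2
  conv_lhs => rw [← List.take_append_drop k (List.finRange (m + 1)), List.drop_eq_getElem_cons hk]
  simp

/-- In the summand of `σ` the position `σ.symm 0` is skipped, so `x 0` never occurs. -/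
theorem capelliDual_congr {m : ℕ} {R : Type*} [Ring R] {x x' : Fin (m + 1) → R}
    (h : ∀ i, i ≠ 0 → x i = x' i) (y : Fin (m + 1) → R) :
    capelliDual x y = capelliDual x' y := by
  refine Finset.sum_congr rfl fun σ _ => ?_
  have hnd := List.nodup_finRange (m + 1)
  rw [List.finRange_split (σ.symm 0), List.nodup_middle, List.nodup_cons, List.mem_append,
    not_or] at hnd
  have key : ∀ j, j ≠ σ.symm 0 → x (σ j) * y j = x' (σ j) * y j := fun j hj => by
    rw [h (σ j) fun h0 => hj (by rw [← h0, symm_apply_apply])]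
  rw [List.map_congr_left fun j hj => key j (ne_of_mem_of_not_mem hj hnd.1.2),
    List.map_congr_left fun j hj => key j (ne_of_mem_of_not_mem hj hnd.1.1)]

variable {K : Type*} [Field K] {n m : ℕ}

/-- The trace of the Capelli polynomial, as an alternating map of the variables `x`. -/
noncomputable def capelliTrace (y : Fin (m + 1) → Matrix (Fin n) (Fin n) K) :
    (Matrix (Fin n) (Fin n) K) [⋀^Fin (m + 1)]→ₗ[K] K :=
  MultilinearMap.alternatization ((Matrix.traceLinearMap (Fin n) K K).compMultilinearMap
    ((MultilinearMap.mkPiAlgebraFin K (m + 1) (Matrix (Fin n) (Fin n) K)).compLinearMap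
      fun j => LinearMap.mulRight K (y j)))

theorem capelliTrace_apply (x y : Fin (m + 1) → Matrix (Fin n) (Fin n) K) :
    capelliTrace y x = ∑ σ : Perm (Fin (m + 1)),
      Perm.sign σ • (List.ofFn fun j => x (σ j) * y j).prod.trace := by
  simp [capelliTrace, MultilinearMap.alternatization_apply]

/-- Cyclicity of the trace rotates each Capelli monomial until `x 0` stands in front. -/
theorem trace_mul_capelliDual (x y : Fin (m + 1) → Matrix (Fin n) (Fin n) K) :
    (x 0 * capelliDual x y).trace = capelliTrace y x := by
  rw [capelliTrace_apply, capelliDual, Finset.mul_sum, Matrix.trace_sum]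
  refine Finset.sum_congr rfl fun σ _ => ?_
  rw [mul_smul_comm, Matrix.trace_smul, List.ofFn_eq_map]
  conv_rhs => rw [List.finRange_split (σ.symm 0)]
  rw [List.map_append, List.prod_append, List.map_cons, List.prod_cons, apply_symm_apply,
    ← mul_assoc, ← mul_assoc, Matrix.trace_mul_comm _ (List.prod _), Units.smul_def]

/-- The trace of the Capelli polynomial, as a multilinear map of the variables `y`. -/
noncomputable def capelliTraceRight (x : Fin (m + 1) → Matrix (Fin n) (Fin n) K) :
    MultilinearMap K (fun _ : Fin (m + 1) => Matrix (Fin n) (Fin n) K) K :=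
  ∑ σ : Perm (Fin (m + 1)), (Perm.sign σ : ℤ) •
    (Matrix.traceLinearMap (Fin n) K K).compMultilinearMap
    ((MultilinearMap.mkPiAlgebraFin K (m + 1) (Matrix (Fin n) (Fin n) K)).compLinearMap
      fun j => LinearMap.mulLeft K (x (σ j)))

theorem capelliTraceRight_apply (x y : Fin (m + 1) → Matrix (Fin n) (Fin n) K) :
    capelliTraceRight x y = capelliTrace y x := by
  simp [capelliTrace_apply, capelliTraceRight, Units.smul_def]

theorem List.prod_ofFn_single (p q : Fin (m + 1) → Fin n) :
    (List.ofFn fun j => (Matrix.single (p j) (q j) 1 : Matrix (Fin n) (Fin n) K)).prod =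
      if ∀ j : Fin m, q j.castSucc = p j.succ then Matrix.single (p 0) (q (Fin.last m)) 1
      else 0 := by
  induction m with
  | zero => simp
  | succ m ih =>
    rw [List.ofFn_succ, List.prod_cons, ih (fun j => p j.succ) (fun j => q j.succ)]
    by_cases h0 : q 0 = p 1
    · by_cases h : ∀ j : Fin m, q j.castSucc.succ = p j.succ.succ
      · have h' : ∀ j : Fin (m + 1), q j.castSucc = p j.succ := Fin.cases h0 h
        rw [if_pos h, if_pos h']
        simp [h0]
      · have h' : ¬ ∀ j : Fin (m + 1), q j.castSucc = p j.succ := fun h' => h fun j => h' j.succ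
        rw [if_neg h, if_neg h', mul_zero]
    · have h' : ¬ ∀ j : Fin (m + 1), q j.castSucc = p j.succ := fun h' => h0 (h' 0)
      rw [if_neg h', mul_ite, mul_zero]
      split_ifs
      · exact Matrix.single_mul_single_of_ne _ _ _ _ h0 _
      · rfl

/-- The `x j` run through all matrix units, and `y j` is the unit linking `x j` to `x (j + 1)`, with
indices cyclic. Each `y j` then fixes the column and the row of its neighbours, so only the identity
permutation gives a nonzero trace. -/
theorem exists_capelliTrace_ne_zero (ρ : Fin (m + 1) ≃ Fin n × Fin n) :
    ∃ y : Fin (m + 1) → Matrix (Fin n) (Fin n) K, capelliTrace y ≠ 0 := by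
  refine ⟨fun j => Matrix.single (ρ j).2 (ρ (j + 1)).1 1, fun h => ?_⟩
  have h1 := DFunLike.congr_fun h fun j => Matrix.single (ρ j).1 (ρ j).2 1
  rw [capelliTrace_apply, Finset.sum_eq_single 1] at h1
  · simp only [Perm.coe_one, id, Matrix.single_mul_single_same, mul_one, Perm.sign_one, one_smul,
      List.prod_ofFn_single (K := K) (fun j => (ρ j).1) (fun j => (ρ (j + 1)).1)] at h1
    simp at h1
  · intro σ _ hσ
    by_contra hne
    refine hσ (Equiv.ext fun j => ρ.injective ?_)
    have hb : ∀ j, (ρ (σ j)).2 = (ρ j).2 := by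
      intro j
      by_contra hj
      refine hne ?_
      rw [List.prod_eq_zero, Matrix.trace_zero, smul_zero]
      rw [List.mem_ofFn]
      exact ⟨j, Matrix.single_mul_single_of_ne _ _ _ _ hj _⟩
    simp only [hb, Matrix.single_mul_single_same, mul_one,
      List.prod_ofFn_single (K := K) (fun j => (ρ (σ j)).1) (fun j => (ρ (j + 1)).1)] at hne
    split_ifs at hne with hc
    · have h0 : (ρ (σ 0)).1 = (ρ 0).1 := by
        by_contra h0
        rw [Fin.last_add_one, Matrix.trace_single_eq_of_ne _ _ _ h0, smul_zero] at hne
        exact hne rfl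
      refine Prod.ext ?_ (hb j)
      refine Fin.cases h0 (fun j => ?_) j
      rw [← hc j, Fin.coeSucc_eq_succ, Perm.one_apply]
    · simp at hne
  · simp

end Capelli

/-! ### Polynomials with values on a line `K v`. -/

section TwistedCommutators

variable {K G : Type*} [Field K] [AddCommGroup G] [DecidableEq G] {n m : ℕ}

theorem exists_eq_trace_mul (f : Matrix (Fin n) (Fin n) K →ₗ[K] K) :
    ∃ w : Matrix (Fin n) (Fin n) K, ∀ x, f x = (w * x).trace := by
  refine ⟨Matrix.of fun j i => f (Matrix.single i j 1), fun x => ?_⟩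
  conv_lhs => rw [Matrix.matrix_eq_sum_single x]
  simp only [map_sum, Matrix.trace, Matrix.diag, Matrix.mul_apply, Matrix.of_apply]
  rw [Finset.sum_comm]
  refine Finset.sum_congr rfl fun j _ => Finset.sum_congr rfl fun i _ => ?_
  rw [show Matrix.single i j (x i j) = x i j • Matrix.single i j 1 by simp, map_smul, smul_eq_mul,
    mul_comm]

/-- An element whose trace pairing vanishes wherever that of `v ≠ 0` does is a multiple
of `v`. -/
theorem eq_smul_of_trace_mul {v w : Matrix (Fin n) (Fin n) K} (hv : v ≠ 0)
    (h : ∀ u, (v * u).trace = 0 → (u * w).trace = 0) : ∃ c : K, w = c • v := by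
  obtain ⟨u, hu⟩ : ∃ u, (v * u).trace ≠ 0 := by
    by_contra! h0
    exact hv (Matrix.ext_iff_trace_mul_right.2 fun x => by simp [h0])
  refine ⟨(u * w).trace / (v * u).trace, Matrix.ext_iff_trace_mul_right.2 fun x => ?_⟩
  have := h (x - ((v * x).trace / (v * u).trace) • u) (by
    simp [mul_sub, Matrix.trace_sub, hu])
  rw [sub_mul, Matrix.trace_sub, smul_mul_assoc, Matrix.trace_smul, sub_eq_zero, smul_eq_mul] at this
  rw [Matrix.trace_mul_comm, this, smul_mul_assoc, Matrix.trace_smul, smul_eq_mul]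
  ring

theorem trace_mul_twisted_commutator {v a b : Matrix (Fin n) (Fin n) K} {c : K}
    (h : v * a = c • (a * v)) : (v * (a * b - c • (b * a))).trace = 0 := by
  rw [mul_sub, Matrix.trace_sub, ← mul_assoc, h, smul_mul_assoc, mul_smul_comm, Matrix.trace_smul,
    Matrix.trace_smul, ← mul_assoc v, Matrix.trace_mul_comm (v * b), mul_assoc, sub_self]

/-- The values of the dual Capelli polynomial at twisted commutators are multiples of `v`. -/
theorem exists_capelliDual_eq_smul (hm : m + 1 = n * n) {v : Matrix (Fin n) (Fin n) K} (hv : v ≠ 0)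
    {x : Fin (m + 1) → Matrix (Fin n) (Fin n) K} (hx : ∀ i, i ≠ 0 → (v * x i).trace = 0)
    (y : Fin (m + 1) → Matrix (Fin n) (Fin n) K) : ∃ c : K, capelliDual x y = c • v := by
  refine eq_smul_of_trace_mul hv fun u hu => ?_
  have hx' : ∀ i, (v * Function.update x 0 u i).trace = 0 := by
    intro i
    by_cases hi : i = 0
    · subst hi; simpa using hu
    · simpa [hi] using hx i hi
  rw [capelliDual_congr (x' := Function.update x 0 u) fun i hi => by simp [hi]]
  have h := trace_mul_capelliDual (Function.update x 0 u) y
  rw [Function.update_self] at h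
  rw [h]
  -- With `u` in slot 0, all `n²` arguments lie in the hyperplane orthogonal to `v`, so they are
  -- dependent and the alternating trace vanishes.
  refine AlternatingMap.map_linearDependent _ _ fun hli => hv ?_
  have htop := hli.span_eq_top_of_card_eq_finrank' (by simp [Module.finrank_matrix, hm])
  refine Matrix.ext_iff_trace_mul_right.2 fun z => ?_
  have hle : Submodule.span K (Set.range (Function.update x 0 u)) ≤
      LinearMap.ker (Matrix.traceLinearMap (Fin n) K K ∘ₗ LinearMap.mulLeft K v) :=
    Submodule.span_le.2 (by rintro _ ⟨i, rfl⟩; exact hx' i)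
  rw [htop] at hle
  simpa using hle (Submodule.mem_top (x := z))

variable (𝒜 : G → Submodule K (Matrix (Fin n) (Fin n) K)) [GradedAlgebra 𝒜]

/-- The twisted commutators of homogeneous elements. -/
def twistedCommutators (χ : G → K) : Set (Matrix (Fin n) (Fin n) K) :=
  {x | ∃ g h, ∃ a ∈ 𝒜 g, ∃ b ∈ 𝒜 h, x = a * b - χ g • (b * a)}

/-- The elements commuting with homogeneous elements up to `χ` are the multiples of `v`. -/
theorem eq_smul_of_twisted_commute {χ : G → K} {v v' w : Matrix (Fin n) (Fin n) K}
    (hvv' : v * v' = 1) (hv : ∀ g, ∀ a ∈ 𝒜 g, v * a = χ g • (a * v))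
    (hw : ∀ g, ∀ a ∈ 𝒜 g, w * a = χ g • (a * w)) : ∃ c : K, w = c • v := by
  have hv'v : v' * v = 1 := mul_eq_one_comm.1 hvv'
  classical
  -- The factors `χ g` from `w` and from the inverse of `v` cancel.
  have hc : v' * w ∈ Subalgebra.center K (Matrix (Fin n) (Fin n) K) := by
    rw [Subalgebra.mem_center_iff]
    intro b
    rw [← DirectSum.sum_support_decompose 𝒜 b, Finset.mul_sum, Finset.sum_mul]
    refine Finset.sum_congr rfl fun g _ => ?_
    obtain ⟨a, ha⟩ := DirectSum.decompose 𝒜 b g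
    change a * (v' * w) = v' * w * a
    rw [mul_assoc v', hw g a ha, mul_smul_comm, ← mul_assoc, ← mul_assoc, ← smul_mul_assoc]
    congr 1
    calc a * v' = v' * (v * a) * v' := by rw [← mul_assoc, hv'v, one_mul]
      _ = χ g • (v' * a) := by
        rw [hv g a ha, mul_smul_comm, smul_mul_assoc, ← mul_assoc, mul_assoc, hvv', mul_one]
  rw [Algebra.IsCentral.center_eq_bot, Algebra.mem_bot] at hc
  obtain ⟨c, hc⟩ := hc
  exact ⟨c, by rw [← one_mul w, ← hvv', mul_assoc, ← hc, Algebra.algebraMap_eq_smul_one,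
    mul_smul_comm, mul_one]⟩

/-- A functional `x ↦ tr(w x)` killing all twisted commutators makes `w` commute with homogeneous
elements up to `χ`, so `w = c v`; vanishing at `u` then forces `c = 0`. -/
theorem span_insert_twistedCommutators {χ : G → K} {v v' u : Matrix (Fin n) (Fin n) K}
    (hvv' : v * v' = 1) (hv : ∀ g, ∀ a ∈ 𝒜 g, v * a = χ g • (a * v)) (hu : (v * u).trace ≠ 0) :
    Submodule.span K (insert u (twistedCommutators 𝒜 χ)) = ⊤ := by
  by_contra hne
  obtain ⟨f, hf0, hf⟩ := Submodule.exists_le_ker_of_lt_top _ (lt_top_iff_ne_top.2 hne)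
  obtain ⟨w, hw⟩ := exists_eq_trace_mul f
  have hfx : ∀ x ∈ insert u (twistedCommutators 𝒜 χ), (w * x).trace = 0 := fun x hx => by
    rw [← hw]
    exact hf (Submodule.subset_span hx)
  obtain ⟨c, rfl⟩ := eq_smul_of_twisted_commute 𝒜 hvv' hv (w := w) (by
    intro g a ha
    refine Matrix.ext_iff_trace_mul_right.2 fun b => ?_
    rw [← sub_eq_zero, ← Matrix.trace_sub, ← sub_mul]
    by_contra hb
    obtain ⟨h, b, hb, hne⟩ := exists_homogeneous_ne_zero 𝒜
      (Matrix.traceLinearMap (Fin n) K K ∘ₗ LinearMap.mulLeft K (w * a - χ g • (a * w))) hb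
    refine hne ?_
    have := hfx _ (Or.inr ⟨g, h, a, ha, b, hb, rfl⟩)
    rw [mul_sub, Matrix.trace_sub, mul_smul_comm, Matrix.trace_smul, ← mul_assoc w b,
      Matrix.trace_mul_comm (w * b)] at this
    simpa [sub_mul, Matrix.trace_sub, mul_assoc] using this)
  have := hfx u (Or.inl rfl)
  rw [smul_mul_assoc, Matrix.trace_smul, smul_eq_zero] at this
  obtain rfl := this.resolve_right hu
  exact hf0 (LinearMap.ext fun x => by simp [hw])

theorem exists_basis_twistedCommutators (hm : m + 1 = n * n) {χ : G → K}
    {v v' u : Matrix (Fin n) (Fin n) K}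
    (hvv' : v * v' = 1) (hv : ∀ g, ∀ a ∈ 𝒜 g, v * a = χ g • (a * v)) (hu : (v * u).trace ≠ 0) :
    ∃ x : Module.Basis (Fin (m + 1)) K (Matrix (Fin n) (Fin n) K),
      ∀ i, i ≠ 0 → x i ∈ twistedCommutators 𝒜 χ := by
  have hu0 : u ≠ 0 := by rintro rfl; simp at hu
  obtain ⟨b, hbt, hub, hspan, hli⟩ := exists_linearIndepOn_id_extension
    (K := K) (s := {u}) (t := insert u (twistedCommutators 𝒜 χ))
    ((linearIndepOn_singleton_iff K).2 hu0) (by simp)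
  have htop : ⊤ ≤ Submodule.span K (Set.range ((↑) : b → Matrix (Fin n) (Fin n) K)) := by
    rw [Subtype.range_coe, ← span_insert_twistedCommutators 𝒜 hvv' hv hu]
    exact Submodule.span_le.2 hspan
  let B := Module.Basis.mk hli htop
  have : Fintype b := FiniteDimensional.fintypeBasisIndex B
  have hcard : Fintype.card b = m + 1 := by
    rw [← Module.finrank_eq_card_basis B, Module.finrank_matrix]
    simp [hm]
  let e₀ := Fintype.equivFinOfCardEq hcard
  let u' : b := ⟨u, hub rfl⟩
  -- The swap puts `u`, possibly not a twisted commutator, at index 0, the slot which `capelliDual`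
  -- ignores.
  let e : b ≃ Fin (m + 1) := e₀.trans (Equiv.swap (e₀ u') 0)
  refine ⟨B.reindex e, fun i hi => ?_⟩
  rw [Module.Basis.reindex_apply, show B (e.symm i) = (e.symm i : Matrix (Fin n) (Fin n) K) from
    Module.Basis.mk_apply hli htop _]
  refine (hbt (e.symm i).2).resolve_left fun h => hi ?_
  have : e.symm i = u' := Subtype.ext h
  rw [← e.apply_symm_apply i, this]
  simp [e]

/-- An alternating map in `n²` matrix variables that is nonzero somewhere is nonzero at every basis;
by multilinearity in `y`, the `y j` may then be taken from a homogeneous basis. -/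
theorem exists_homogeneous_capelliTrace_ne_zero (hm : m + 1 = n * n)
    (x : Module.Basis (Fin (m + 1)) K (Matrix (Fin n) (Fin n) K)) :
    ∃ (d : Fin (m + 1) → G) (y : Fin (m + 1) → Matrix (Fin n) (Fin n) K),
      (∀ j, y j ∈ 𝒜 (d j)) ∧ capelliTrace y x ≠ 0 := by
  obtain ⟨y₀, hy₀⟩ := exists_capelliTrace_ne_zero (K := K) (m := m)
    ((finCongr hm).trans finProdFinEquiv.symm)
  rw [← AlternatingMap.map_basis_ne_zero_iff x, ← capelliTraceRight_apply] at hy₀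
  let B := (DirectSum.Decomposition.isInternal 𝒜).collectedBasis
    fun g => Module.finBasis K (𝒜 g)
  by_contra! h
  refine hy₀ ?_
  have : capelliTraceRight x = 0 := Module.Basis.ext_multilinear (fun _ => B) fun i => by
    rw [capelliTraceRight_apply]
    exact h (fun j => (i j).1) _ fun j =>
      (DirectSum.Decomposition.isInternal 𝒜).collectedBasis_mem _ _
  rw [this]
  rfl

/-- There is a graded polynomial whose values are multiples of `v`, and which is not a graded
identity. -/
theorem exists_polynomial_values_smul (hn : 0 < n) {χ : G → K}
    {v v' : Matrix (Fin n) (Fin n) K}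
    (hvv' : v * v' = 1) (hv : ∀ g, ∀ a ∈ 𝒜 g, v * a = χ g • (a * v)) :
    ∃ f : GradedPolynomial K G,
      (∀ a, AdmissibleSubstitution 𝒜 a → ∃ c : K, FreeAlgebra.lift K a f = c • v) ∧
      ∃ a, AdmissibleSubstitution 𝒜 a ∧ FreeAlgebra.lift K a f ≠ 0 := by
  obtain ⟨m, hm⟩ : ∃ m, m + 1 = n * n :=
    ⟨n * n - 1, Nat.sub_add_cancel (Nat.mul_pos hn hn)⟩
  have : Nonempty (Fin n) := ⟨⟨0, hn⟩⟩
  have hv0 : v ≠ 0 := by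
    rintro rfl
    rw [zero_mul] at hvv'
    exact zero_ne_one hvv'
  obtain ⟨u, hu⟩ : ∃ u, (v * u).trace ≠ 0 := by
    by_contra! h0
    exact hv0 (Matrix.ext_iff_trace_mul_right.2 fun x => by simp [h0])
  obtain ⟨x, hx⟩ := exists_basis_twistedCommutators 𝒜 hm hvv' hv hu
  obtain ⟨d, y, hy, hxy⟩ := exists_homogeneous_capelliTrace_ne_zero 𝒜 hm x
  have hx' : ∀ i, ∃ g h, ∃ a ∈ 𝒜 g, ∃ b ∈ 𝒜 h, i ≠ 0 → x i = a * b - χ g • (b * a) := by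
    intro i
    by_cases hi : i = 0
    · exact ⟨0, 0, 0, zero_mem _, 0, zero_mem _, fun h => absurd hi h⟩
    · obtain ⟨g, h, a, ha, b, hb, hab⟩ := hx i hi
      exact ⟨g, h, a, ha, b, hb, fun _ => hab⟩
  choose p q a ha b hb hab using hx'
  -- Distinct numbers keep the three families of variables independent even when degrees coincide.
  let enc : Fin (m + 1) ⊕ (Fin (m + 1) ⊕ Fin (m + 1)) → ℕ := Encodable.encode
  let Y : Fin (m + 1) → GradedPolynomial K G := fun j => FreeAlgebra.ι K (d j, enc (.inl j))
  let P : Fin (m + 1) → GradedPolynomial K G := fun j => FreeAlgebra.ι K (p j, enc (.inr (.inl j)))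
  let R : Fin (m + 1) → GradedPolynomial K G := fun j => FreeAlgebra.ι K (q j, enc (.inr (.inr j)))
  refine ⟨capelliDual (fun i => P i * R i - χ (p i) • (R i * P i)) Y, fun s hs => ?_, ?_⟩
  · rw [map_capelliDual]
    refine exists_capelliDual_eq_smul hm hv0 (fun i _ => ?_) _
    simp only [Function.comp_apply, map_sub, map_mul, map_smul, P, R, FreeAlgebra.lift_ι_apply]
    exact trace_mul_twisted_commutator (hv _ _ (hs (p i, enc (.inr (.inl i)))))
  -- Taking the component of degree `z.1` makes the substitution admissible at every variable,
  -- including those outside the polynomial.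
  · let val : G × ℕ → Matrix (Fin n) (Fin n) K := fun z =>
      DirectSum.decompose 𝒜 (((Encodable.decode z.2).map (Sum.elim y (Sum.elim a b))).getD 0) z.1
    have hval : ∀ g i, Sum.elim y (Sum.elim a b) i ∈ 𝒜 g →
        val (g, enc i) = Sum.elim y (Sum.elim a b) i := by
      intro g i hi
      simp only [val, enc, Encodable.encodek, Option.map_some, Option.getD_some]
      exact DirectSum.decompose_of_mem_same 𝒜 hi
    refine ⟨val, fun z => SetLike.coe_mem _, fun h0 => hxy ?_⟩
    have hY : (FreeAlgebra.lift K val) ∘ Y = y := by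
      funext j
      simp only [Function.comp_apply, Y, FreeAlgebra.lift_ι_apply]
      exact hval _ (.inl j) (hy j)
    rw [map_capelliDual, hY, capelliDual_congr (x' := x)] at h0
    · rw [← trace_mul_capelliDual, h0, mul_zero, Matrix.trace_zero]
    · intro i hi
      have h1 := hval (p i) (.inr (.inl i)) (ha i)
      have h2 := hval (q i) (.inr (.inr i)) (hb i)
      simp only [Sum.elim_inr, Sum.elim_inl] at h1 h2
      simp only [Function.comp_apply, map_sub, map_mul, map_smul, P, R, FreeAlgebra.lift_ι_apply,
        h1, h2, hab i hi]

end TwistedCommutators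

/-! ### Characters acting by inner automorphisms. -/

section CharacterAction

variable {K G A : Type*} [Field K] [AddCommGroup G] [DecidableEq G] [Ring A] [Algebra K A]
  (𝒜 : G → Submodule K A) [GradedAlgebra 𝒜]

/-- The endomorphism of a graded algebra multiplying the component of degree `g` by `χ g`. -/
noncomputable def characterHom (χ : Multiplicative G →* K) : A →ₐ[K] A :=
  (DirectSum.toAlgebra K (fun g => 𝒜 g) (fun g => χ (.ofAdd g) • (𝒜 g).subtype)
    (by simp) (fun {g h} a b => by
      simp [smul_smul, mul_comm])).comp (DirectSum.decomposeAlgEquiv 𝒜 : A →ₐ[K] _)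

theorem characterHom_apply (χ : Multiplicative G →* K) {g : G} {a : A} (ha : a ∈ 𝒜 g) :
    characterHom 𝒜 χ a = χ (.ofAdd g) • a := by
  have h : characterHom 𝒜 χ a = DirectSum.toAddMonoid
    (fun g => (χ (.ofAdd g) • (𝒜 g).subtype).toAddMonoidHom) (DirectSum.decompose 𝒜 a) := rfl
  rw [h, DirectSum.decompose_of_mem 𝒜 ha, DirectSum.toAddMonoid_of]
  rfl

theorem algHom_ext_homogeneous {B : Type*} [Ring B] [Algebra K B] {φ ψ : A →ₐ[K] B}
    (h : ∀ g, ∀ a ∈ 𝒜 g, φ a = ψ a) : φ = ψ := by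
  classical
  ext a
  rw [← DirectSum.sum_support_decompose 𝒜 a, map_sum, map_sum]
  exact Finset.sum_congr rfl fun g _ => h g _ (SetLike.coe_mem _)

/-- The automorphism of a graded algebra multiplying the component of degree `g` by `χ g`. -/
noncomputable def characterEquiv (χ : Multiplicative G →* Kˣ) : A ≃ₐ[K] A :=
  AlgEquiv.ofAlgHom (characterHom 𝒜 ((Units.coeHom K).comp χ))
    (characterHom 𝒜 ((Units.coeHom K).comp χ⁻¹))
    (algHom_ext_homogeneous 𝒜 fun g a ha => by
      simp [characterHom_apply 𝒜 _ ha, smul_smul])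
    (algHom_ext_homogeneous 𝒜 fun g a ha => by
      simp [characterHom_apply 𝒜 _ ha, smul_smul])

theorem characterEquiv_apply (χ : Multiplicative G →* Kˣ) {g : G} {a : A} (ha : a ∈ 𝒜 g) :
    characterEquiv 𝒜 χ a = (χ (.ofAdd g) : K) • a :=
  characterHom_apply 𝒜 _ ha

/-- Automorphisms of a matrix algebra are inner. -/
theorem Matrix.exists_algEquiv_eq_conj {n : ℕ}
    (φ : Matrix (Fin n) (Fin n) K ≃ₐ[K] Matrix (Fin n) (Fin n) K) :
    ∃ v v' : Matrix (Fin n) (Fin n) K, v * v' = 1 ∧ ∀ a, φ a = v * a * v' := by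
  let L : Matrix (Fin n) (Fin n) K ≃ₐ[K] ((Fin n → K) →ₗ[K] (Fin n → K)) := Matrix.toLinAlgEquiv'
  obtain ⟨T, hT⟩ := ((L.symm.trans φ).trans L).eq_linearEquivConjAlgEquiv
  refine ⟨L.symm T.toLinearMap, L.symm T.symm.toLinearMap, ?_, fun a => ?_⟩
  · apply L.injective
    rw [map_mul, AlgEquiv.apply_symm_apply, AlgEquiv.apply_symm_apply, map_one]
    ext; simp
  · apply L.injective
    have := DFunLike.congr_fun hT (L a)
    rw [map_mul, map_mul, AlgEquiv.apply_symm_apply, AlgEquiv.apply_symm_apply]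
    simp only [AlgEquiv.trans_apply, AlgEquiv.symm_apply_apply] at this
    rw [this]
    rfl

end CharacterAction

/-! ### Consequences of the primeness property. -/

section Primeness

variable {K G : Type*} [Field K]

theorem inVariables_lift (ρ : G × ℕ → G × ℕ) (f : GradedPolynomial K G) :
    GradedPolynomial.InVariables (FreeAlgebra.lift K (FreeAlgebra.ι K ∘ ρ) f) (Set.range ρ) := by
  unfold GradedPolynomial.InVariables
  induction f using FreeAlgebra.induction with
  | grade0 r => rw [AlgHom.commutes]; exact Subalgebra.algebraMap_mem _ r
  | grade1 z =>
    rw [FreeAlgebra.lift_ι_apply]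
    exact Algebra.subset_adjoin ⟨ρ z, ⟨z, rfl⟩, rfl⟩
  | mul a b ha hb => rw [map_mul]; exact mul_mem ha hb
  | add a b ha hb => rw [map_add]; exact add_mem ha hb

theorem lift_lift_rename {A : Type*} [Ring A] [Algebra K A] (ρ : G × ℕ → G × ℕ) (a : G × ℕ → A)
    (f : GradedPolynomial K G) :
    FreeAlgebra.lift K a (FreeAlgebra.lift K (FreeAlgebra.ι K ∘ ρ) f) =
      FreeAlgebra.lift K (a ∘ ρ) f := by
  have : (FreeAlgebra.lift K a).comp (FreeAlgebra.lift K (FreeAlgebra.ι K ∘ ρ)) =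
      FreeAlgebra.lift K (a ∘ ρ) := by
    ext; simp
  exact DFunLike.congr_fun this f

/-- If the values of two non-identities are multiples of mutually inverse elements `v` and `v'`,
the primeness property makes `v` central. -/
theorem HasPrimenessProperty.mem_center {A : Type*} [Ring A] [Algebra K A]
    {𝒜 : G → Submodule K A} (h𝒜 : HasPrimenessProperty 𝒜) {v v' : A} (hvv' : v * v' = 1)
    {f₁ f₂ : GradedPolynomial K G}
    (h₁ : ∀ a, AdmissibleSubstitution 𝒜 a → ∃ c : K, FreeAlgebra.lift K a f₁ = c • v)
    (h₂ : ∀ a, AdmissibleSubstitution 𝒜 a → ∃ c : K, FreeAlgebra.lift K a f₂ = c • v')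
    (hne₁ : ∃ a, AdmissibleSubstitution 𝒜 a ∧ FreeAlgebra.lift K a f₁ ≠ 0)
    (hne₂ : ∃ a, AdmissibleSubstitution 𝒜 a ∧ FreeAlgebra.lift K a f₂ ≠ 0) :
    v ∈ Subalgebra.center K A := by
  obtain ⟨a₁, ha₁, hne₁⟩ := hne₁
  obtain ⟨a₂, ha₂, hne₂⟩ := hne₂
  -- Even and odd numbering separates the variables of the two polynomials while preserving degrees.
  let ρ₁ : G × ℕ → G × ℕ := fun z => (z.1, 2 * z.2)
  let ρ₂ : G × ℕ → G × ℕ := fun z => (z.1, 2 * z.2 + 1)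
  let a : G × ℕ → A := fun z => if z.2 % 2 = 0 then a₁ (z.1, z.2 / 2) else a₂ (z.1, z.2 / 2)
  have ha : AdmissibleSubstitution 𝒜 a := by
    intro z
    simp only [a]
    split_ifs
    · exact ha₁ (z.1, z.2 / 2)
    · exact ha₂ (z.1, z.2 / 2)
  have hρ₁ : a ∘ ρ₁ = a₁ := by
    funext z
    simp [a, ρ₁]
  have hρ₂ : a ∘ ρ₂ = a₂ := by
    funext z
    have : (2 * z.2 + 1) / 2 = z.2 := by omega
    simp [a, ρ₂, this]
  have hdisj : Disjoint (Set.range ρ₁) (Set.range ρ₂) := by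
    rw [Set.disjoint_left]
    rintro _ ⟨z, rfl⟩ ⟨w, hw⟩
    have := congrArg Prod.snd hw
    simp only [ρ₁, ρ₂] at this
    omega
  obtain ⟨c₁, hc₁⟩ := h₁ a₁ ha₁
  obtain ⟨c₂, hc₂⟩ := h₂ a₂ ha₂
  have hc₁0 : c₁ ≠ 0 := by rintro rfl; exact hne₁ (by rw [hc₁, zero_smul])
  have hc₂0 : c₂ ≠ 0 := by rintro rfl; exact hne₂ (by rw [hc₂, zero_smul])
  have h1 : (1 : A) ≠ 0 := by
    intro h0
    exact hne₁ (by rw [← one_mul (FreeAlgebra.lift K a₁ f₁), h0, zero_mul])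
  obtain ⟨⟨hcentral, -⟩, -⟩ := h𝒜 _ _ _ _ hdisj (inVariables_lift ρ₁ f₁) (inVariables_lift ρ₂ f₂) (by
    refine ⟨fun s hs => ?_, fun hid => ?_⟩
    · rw [map_mul, lift_lift_rename, lift_lift_rename]
      obtain ⟨c, hc⟩ := h₁ (s ∘ ρ₁) fun z => hs (ρ₁ z)
      obtain ⟨d, hd⟩ := h₂ (s ∘ ρ₂) fun z => hs (ρ₂ z)
      rw [hc, hd, smul_mul_smul_comm, hvv']
      exact Subalgebra.smul_mem _ (one_mem _) _
    · have := hid a ha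
      rw [map_mul, lift_lift_rename, lift_lift_rename, hρ₁, hρ₂, hc₁, hc₂, smul_mul_smul_comm,
        hvv'] at this
      exact (smul_ne_zero (mul_ne_zero hc₁0 hc₂0) h1) this)
  have := hcentral a ha
  rw [lift_lift_rename, hρ₁, hc₁] at this
  rw [← one_smul K v, ← inv_mul_cancel₀ hc₁0, mul_smul]
  exact Subalgebra.smul_mem _ this _

/-- A grading of a matrix algebra with the primeness property is concentrated in degree `0`. -/
theorem HasPrimenessProperty.eq_bot_of_ne_zero [IsAlgClosed K] [CharZero K]
    [AddCommGroup G] [Finite G] [DecidableEq G] {n : ℕ} (hn : 0 < n) (Γ : G → Submodule K (Matrix (Fin n) (Fin n) K))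
    [GradedAlgebra Γ] (hΓ : HasPrimenessProperty Γ) {g : G} (hg : g ≠ 0) : Γ g = ⊥ := by
  -- An algebraically closed field of characteristic 0 has enough roots of unity for some character
  -- to be nontrivial at `g`.
  obtain ⟨χ, hχ⟩ := CommGroup.exists_apply_ne_one_of_hasEnoughRootsOfUnity (Multiplicative G) K
    (a := .ofAdd g) (by simpa using hg)
  obtain ⟨v, v', hvv', hv⟩ := Matrix.exists_algEquiv_eq_conj (characterEquiv Γ χ)
  have hv'v : v' * v = 1 := mul_eq_one_comm.1 hvv'
  have hcomm : ∀ g, ∀ a ∈ Γ g, v * a = (χ (.ofAdd g) : K) • (a * v) := by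
    intro g a ha
    rw [← smul_mul_assoc, ← characterEquiv_apply Γ χ ha, hv, mul_assoc _ v', hv'v, mul_one]
  have hcomm' : ∀ g, ∀ a ∈ Γ g, v' * a = ((χ (.ofAdd g))⁻¹ : Kˣ).val • (a * v') := by
    intro g a ha
    have h : a = (χ (.ofAdd g) : K) • (v' * a * v) := by
      rw [mul_assoc, ← mul_smul_comm, ← hcomm g a ha, ← mul_assoc, hv'v, one_mul]
    nth_rw 2 [h]
    rw [smul_mul_assoc, smul_smul, Units.inv_mul, one_smul, mul_assoc _ v, hvv', mul_one]
  obtain ⟨f₁, h₁, hne₁⟩ := exists_polynomial_values_smul Γ hn hvv' hcomm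
  obtain ⟨f₂, h₂, hne₂⟩ := exists_polynomial_values_smul Γ hn hv'v hcomm'
  have hcenter := hΓ.mem_center hvv' h₁ h₂ hne₁ hne₂
  rw [eq_bot_iff]
  intro a ha
  have h1 := hcomm g a ha
  rw [← Subalgebra.mem_center_iff.1 hcenter a] at h1
  -- With `v` central, the relation `v a = χ(g) a v` becomes `a = χ(g) a`.
  have h2 : (1 - (χ (.ofAdd g) : K)) • a = 0 := by
    have h3 : a = (χ (.ofAdd g) : K) • a := by
      have := congrArg (· * v') h1
      simpa [mul_assoc, hvv'] using this
    rw [sub_smul, one_smul, ← h3, sub_self]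
  refine (smul_eq_zero.1 h2).resolve_left fun h => hχ (Units.ext ?_)
  rw [Units.val_one, sub_eq_zero.1 h]

/-- The trivial grading is the elementary grading of a constant tuple. -/
theorem isElementaryGrading_of_eq_bot [AddCommGroup G] [DecidableEq G] {n : ℕ}
    (Γ : G → Submodule K (Matrix (Fin n) (Fin n) K)) [GradedAlgebra Γ]
    (h : ∀ g, g ≠ 0 → Γ g = ⊥) : IsElementaryGrading Γ := by
  classical
  refine ⟨0, fun g => ?_⟩
  by_cases hg : g = 0
  · subst hg
    trans ⊤
    · rw [eq_top_iff]
      intro x _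
      rw [← DirectSum.sum_support_decompose Γ x]
      refine sum_mem fun g _ => ?_
      by_cases hg : g = 0
      · subst hg
        exact SetLike.coe_mem _
      · have hx : ∀ y ∈ Γ g, y = 0 := fun y hy => by rwa [h g hg, Submodule.mem_bot] at hy
        rw [hx _ (SetLike.coe_mem _)]
        exact zero_mem _
    · symm
      rw [eq_top_iff]
      intro x _
      rw [Matrix.matrix_eq_sum_single x]
      refine sum_mem fun i _ => sum_mem fun j _ => ?_
      rw [show Matrix.single i j (x i j) = x i j • Matrix.single i j 1 by simp]
      exact Submodule.smul_mem _ _ (Submodule.subset_span ⟨i, j, by simp, rfl⟩)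
  · rw [h g hg, elementaryGrading, eq_comm, Submodule.span_eq_bot]
    rintro _ ⟨i, j, hij, rfl⟩
    exact absurd (by simpa using hij.symm) hg

end Primeness

theorem mainTheorem5 {K : Type*} [Field K] [IsAlgClosed K] [CharZero K]
    {G : Type*} [AddCommGroup G] [Finite G] [DecidableEq G]
    {n : ℕ} (hn : 0 < n)
    (Γ : G → Submodule K (Matrix (Fin n) (Fin n) K)) [GradedAlgebra Γ] :
    (∃ (Q : AddSubgroup G) (α : TwoCocycle Q K) (r : ℕ) (t : Fin r → G),
      0 < r ∧ GradedIsomorphic Γ (tensorGrading α t)) ∧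
    ∀ (Q : AddSubgroup G) (α : TwoCocycle Q K) (r : ℕ) (t : Fin r → G),
      0 < r → GradedIsomorphic Γ (tensorGrading α t) →
        (¬ α.HasTrivialBicharacter → HasPrimenessProperty Γ → IsElementaryGrading Γ) ∧
        (α.HasTrivialBicharacter →
          (HasPrimenessProperty Γ ↔ HasPrimenessProperty (elementaryGrading K t))) := by
  have : Nonempty (Fin n) := ⟨⟨0, hn⟩⟩
  refine ⟨exists_gradedIsomorphic_tensorGrading Γ Matrix.exists_mul_mul_ne_zero,
    fun Q α r t hr hiso => ⟨fun _ hΓ => ?_, fun hα => ?_⟩⟩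
  · exact isElementaryGrading_of_eq_bot Γ fun g hg => hΓ.eq_bot_of_ne_zero hn Γ hg
  · obtain ⟨φ, -⟩ := id hiso
    have := subsingleton_of_hasTrivialBicharacter hα hr φ
    exact (hiso.trans (gradedIsomorphic_elementaryGrading α t)).hasPrimenessProperty_iff
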